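/- Let $n\ge 1$ and let $B=M_n(\mathbb C)\oplus M_n(\mathbb C)\oplus M_n(\mathbb C)$. For a faithful state $\psi$ on $B$ let $m^*:B\to B\otimes B$ be the adjoint of the multiplication $m$ with respect to the inner products induced by $\psi\otimes\psi$ and $\psi$; for $\delta>0$, $\psi$ is a $\delta$-form if $mm^*=\delta^2\,\mathrm{id}_B$. There is exactly one tracial state $\psi$ on $B$ that is a $\delta$-form for some $\delta>0$. With this $\psi$ and $\delta$, the map \[A(x_1\oplus x_2\oplus x_3)=(x_1+x_2+x_3)\oplus(x_1+x_2)\oplus 0\] is completely positive and satisfies $m(A\otimes A)m^*=\delta^2A$, so $\mathcal G=(B,\psi,A)$ is a quantum graph. Put $\varepsilon_{\mathcal G}=\delta^{-2}(\mathrm{id}\otimes A)m^*(1)$ and let the quantum edge correspondence $E_{\mathcal G}=\mathrm{span}\{x\cdot\varepsilon_{\mathcal G}\cdot y: x,y\in B\}$ be the subcorrespondence of $B\otimes_\psi B$ it generates, where $a\cdot(x\otimes y)\cdot b=ax\otimes yb$ and $\langle x\otimes y\,|\,x'\otimes y'\rangle=y^*\psi(x^*x')y'$. For a C*-correspondence $X$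 over $B$ with universal covariant representation $(\pi,t)$ in the Cuntz--Pimsner algebra $\mathcal O_X$, a vector $\xi\in X^{\otimes m}$ is non-returning if $t^m(\xi)^*t^k(\eta)t^m(\xi)=0$ for all $0<k<m$ and $\eta\in X^{\otimes k}$, and $X$ satisfies Condition (S) if for every positive $x\in B$, every $k\in\mathbb N$ and every $\epsilon>0$ there are $m>k$ and a non-returning unit vector $\xi\in X^{\otimes m}$ with $\|x\|<\|\langle\xi\,|\,x\cdot\xi\rangle\|+\epsilon$. Then $E_{\mathcal G}$ satisfies Condition (S). Moreover, let $1_1,1_2,1_3$ be the central projections onto the three summands. For every $x\in B$ there are $a\ne b$ in $\{1,2,3\}$ such that for every $m\ge1$ the vector $(1_a\cdot\varepsilon_{\mathcal G}\cdot 1_b)\otimes(\varepsilon_{\mathcal G}\cdot 1_b)\otimes\cdots\otimes(\varepsilon_{\mathcal G}\cdot 1_b)\in E_{\mathcal G}^{\otimes m}$ has a positive multiple $\xi$ that is a non-returning unit vector with $\|\langle\xi\,|\,x\cdot\xi\rangle\|=\|x\|$. -/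

import Mathlib

open scoped Matrix.Norms.L2Operator MatrixOrder ComplexOrder TensorProduct ENNReal

noncomputable section

namespace QuantumGraphs

universe u

/-- A finite-dimensional C*-correspondence over a unital C*-algebra `B`: a right Hilbert
`B`-module `X`, with the inner product `⟨x | y⟩` conjugate-linear in `x` and linear in `y`, and a
left action of `B` by adjointable operators.  (Mathlib's `CStarModule` has
`⟨x | a • y⟩ = a * ⟨x | y⟩`, which is not the law `⟨x | y · b⟩ = ⟨x | y⟩ b` of a right module.)
A finite-dimensional inner product module is complete, so completeness is not a field. -/
structure Correspondence (B : Type u) [CStarAlgebra B] [PartialOrder B] [StarOrderedRing B] where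
  carrier : Type u
  [addCommGroup : AddCommGroup carrier]
  [module : Module ℂ carrier]
  [finiteDimensional : FiniteDimensional ℂ carrier]
  /-- the left action, `left b x = b · x` -/
  left : B →ₗ[ℂ] carrier →ₗ[ℂ] carrier
  /-- the right action, `right b x = x · b` -/
  right : B →ₗ[ℂ] carrier →ₗ[ℂ] carrier
  /-- the inner product, `inner x y = ⟨x | y⟩` -/
  inner : carrier →ₗ⋆[ℂ] carrier →ₗ[ℂ] B
  left_mul : ∀ b c x, left (b * c) x = left b (left c x)
  right_mul : ∀ b c x, right (b * c) x = right c (right b x)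
  right_one : ∀ x, right 1 x = x
  star_inner : ∀ x y, star (inner x y) = inner y x
  inner_right : ∀ b x y, inner x (right b y) = inner x y * b
  inner_left : ∀ b x y, inner (left b x) y = inner x (left (star b) y)
  inner_self_nonneg : ∀ x, 0 ≤ inner x x
  eq_zero_of_inner_self : ∀ x, inner x x = 0 → x = 0

attribute [instance] Correspondence.addCommGroup Correspondence.module
  Correspondence.finiteDimensional

section Positivity

variable {B : Type u} [CStarAlgebra B] [PartialOrder B] [StarOrderedRing B]

/-- A selfadjoint `M` is positive if `N* M N = -S* S` forces `S = 0`. -/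
theorem nonneg_of_forall {A : Type u} [CStarAlgebra A] [PartialOrder A] [StarOrderedRing A]
    (M : A) (hM : IsSelfAdjoint M) (h : ∀ N S : A, star N * (M * N) = -(star S * S) → S = 0) :
    0 ≤ M := by
  set N := M⁻ with hN
  have hNpos : 0 ≤ N := CFC.negPart_nonneg M
  have hNsa : star N = N := (IsSelfAdjoint.of_nonneg hNpos).star_eq
  have hMN : M * N = -(N * N) := by
    conv_lhs => rw [← CFC.posPart_sub_negPart M hM]
    rw [sub_mul, CFC.posPart_mul_negPart, zero_sub]
  obtain ⟨R, hR⟩ := CStarAlgebra.nonneg_iff_eq_star_mul_self.mp hNpos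
  have key : star N * (M * N) = -(star (R * N) * (R * N)) := by
    rw [hMN, hNsa, star_mul, hNsa, mul_neg, mul_assoc N (star R), ← mul_assoc (star R) R, ← hR]
  have hS : R * N = 0 := h N _ key
  have hNN : N * N = 0 := by
    nth_rewrite 1 [hR]
    rw [mul_assoc, hS, mul_zero]
  have hN0 : N = 0 := by
    rw [← CStarRing.star_mul_self_eq_zero_iff, hNsa, hNN]
  rw [← CFC.posPart_sub_negPart M hM, ← hN, hN0, sub_zero]
  exact CFC.posPart_nonneg M

theorem exists_eq_star_mul_self {A : Type u} [CStarAlgebra A] [PartialOrder A]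
    [StarOrderedRing A] (M : A) (hM : 0 ≤ M) : ∃ C, M = star C * C :=
  CStarAlgebra.nonneg_iff_eq_star_mul_self.mp hM

/-- If `v* M v ≥ 0` for all columns `v` then the matrix `M = M*` is positive. -/
theorem cstarMatrix_nonneg {k : ℕ} (M : CStarMatrix (Fin k) (Fin k) B) (hM : IsSelfAdjoint M)
    (h : ∀ v : Fin k → B, 0 ≤ ∑ i, ∑ j, star (v i) * M i j * v j) : 0 ≤ M := by
  refine nonneg_of_forall M hM fun N S key => ?_
  have hdiag : ∀ j, (∑ i, star (S i j) * S i j) = 0 := by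
    intro j
    apply le_antisymm
    · have h1 := h (fun i => N i j)
      have h2 : (∑ i, ∑ l, star (N i j) * M i l * N l j) = (star N * (M * N)) j j := by
        simp only [CStarMatrix.mul_apply, CStarMatrix.star_apply, Finset.mul_sum, mul_assoc]
      rw [h2, key] at h1
      have h3 : (-(star S * S)) j j = -(∑ i, star (S i j) * S i j) := by
        rw [CStarMatrix.neg_apply, CStarMatrix.mul_apply]
        rfl
      rw [h3] at h1
      exact neg_nonneg.mp h1
    · exact Finset.sum_nonneg fun i _ => star_mul_self_nonneg _
  apply CStarMatrix.ext
  intro i j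
  have := (Finset.sum_eq_zero_iff_of_nonneg
    (fun i _ => star_mul_self_nonneg (S i j))).mp (hdiag j) i (Finset.mem_univ i)
  exact CStarRing.star_mul_self_eq_zero_iff _ |>.mp this

/-- In a semi-inner product module, null vectors are orthogonal to every vector. -/
theorem form_eq_zero {V : Type u} [AddCommGroup V] [Module ℂ V] (F : V →ₗ⋆[ℂ] V →ₗ[ℂ] B)
    (R : B → V → V) (hR : ∀ b x y, F x (R b y) = F x y * b)
    (hs : ∀ x y, star (F x y) = F y x) (hp : ∀ x, 0 ≤ F x x) (z w : V) (hz : F z z = 0) :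
    F z w = 0 := by
  set b := F z w with hb
  have hR' : ∀ b x y, F (R b x) y = star b * F x y := fun b x y => by
    rw [← hs, hR, star_mul, hs]
  have hwz : F w z = star b := by rw [hb, hs]
  have h1 : ∀ t : ℝ, (2 * t) • (star b * b) ≤ F w w := fun t => by
    have := hp (w - (t : ℂ) • R b z)
    simp only [map_sub, LinearMap.sub_apply, map_smul, LinearMap.map_smulₛₗ, LinearMap.smul_apply,
      hR, hR', hz, hwz, ← hb, Complex.conj_ofReal, mul_zero, zero_mul, smul_zero, sub_zero] at this
    rw [← sub_nonneg]
    convert this using 1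
    simp only [Complex.coe_smul]
    rw [mul_smul, two_smul]
    abel
  have h2 : ∀ t : ℝ, 0 < t → 2 * t * ‖star b * b‖ ≤ ‖F w w‖ := fun t ht => by
    have := CStarAlgebra.norm_le_norm_of_nonneg_of_le
      (smul_nonneg (by positivity : 0 ≤ 2 * t) (star_mul_self_nonneg b)) (h1 t)
    rwa [norm_smul, Real.norm_of_nonneg (by positivity)] at this
  by_contra hne
  have hpos : 0 < ‖star b * b‖ := by
    rw [norm_pos_iff]
    exact fun h => hne (CStarRing.star_mul_self_eq_zero_iff _ |>.mp h)
  have := h2 ((‖F w w‖ + 1) / ‖star b * b‖) (by positivity)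
  rw [mul_assoc, div_mul_cancel₀ _ hpos.ne'] at this
  linarith [norm_nonneg (F w w)]

end Positivity

namespace Correspondence

variable {B : Type u} [CStarAlgebra B] [PartialOrder B] [StarOrderedRing B]

/-- `‖x‖ = ‖⟨x | x⟩‖^(1/2)`. -/
def norm (X : Correspondence B) (x : X.carrier) : ℝ := Real.sqrt ‖X.inner x x‖

theorem inner_left' (X : Correspondence B) (b : B) (x y : X.carrier) :
    X.inner x (X.left b y) = X.inner (X.left (star b) x) y := by
  rw [X.inner_left, star_star]

theorem inner_right_left (X : Correspondence B) (b : B) (x y : X.carrier) :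
    X.inner (X.right b x) y = star b * X.inner x y := by
  rw [← X.star_inner, X.inner_right, star_mul, X.star_inner]

theorem ext_inner (X : Correspondence B) {x y : X.carrier}
    (h : ∀ z, X.inner z x = X.inner z y) : x = y := by
  rw [← sub_eq_zero]
  apply X.eq_zero_of_inner_self
  rw [map_sub (X.inner (x - y)), h, sub_self]

theorem left_right (X : Correspondence B) (b c : B) (x : X.carrier) :
    X.left b (X.right c x) = X.right c (X.left b x) := by
  apply X.ext_inner
  intro z
  rw [X.inner_left', X.inner_right, X.inner_right, X.inner_left']

theorem gram_nonneg (X : Correspondence B) {k : ℕ} (x : Fin k → X.carrier) :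
    0 ≤ (CStarMatrix.ofMatrix (fun i j => X.inner (x i) (x j)) :
      CStarMatrix (Fin k) (Fin k) B) := by
  apply cstarMatrix_nonneg
  · apply CStarMatrix.ext
    intro i j
    exact X.star_inner (x j) (x i)
  · intro v
    have := X.inner_self_nonneg (∑ i, X.right (v i) (x i))
    simp only [map_sum, LinearMap.sum_apply, X.inner_right, X.inner_right_left] at this
    rw [Finset.sum_comm] at this
    exact this

section Tensor

variable (X Y : Correspondence B)

/-- The form `⟨x ⊗ y | x' ⊗ y'⟩ = ⟨y | ⟨x | x'⟩ · y'⟩` on the algebraic tensor product. -/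
def tensorForm : X.carrier ⊗[ℂ] Y.carrier →ₗ⋆[ℂ] X.carrier ⊗[ℂ] Y.carrier →ₗ[ℂ] B :=
  TensorProduct.lift <| LinearMap.mk₂'ₛₗ (starRingEnd ℂ) (starRingEnd ℂ)
    (fun x y => TensorProduct.lift <| LinearMap.mk₂ ℂ
      (fun x' y' => Y.inner y (Y.left (X.inner x x') y'))
      (by intros; simp) (by intros; simp) (by intros; simp) (by intros; simp))
    (by intros; ext; simp) (by intros; ext; simp) (by intros; ext; simp) (by intros; ext; simp)

@[simp] theorem tensorForm_tmul (x x' : X.carrier) (y y' : Y.carrier) :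
    tensorForm X Y (x ⊗ₜ y) (x' ⊗ₜ y') = Y.inner y (Y.left (X.inner x x') y') := rfl

theorem star_tensorForm (z w : X.carrier ⊗[ℂ] Y.carrier) :
    star (tensorForm X Y z w) = tensorForm X Y w z := by
  induction z with
  | zero => simp
  | add z z' hz hz' => simp [hz, hz']
  | tmul x y =>
    induction w with
    | zero => simp
    | add w w' hw hw' => simp [hw, hw']
    | tmul x' y' =>
      rw [tensorForm_tmul, tensorForm_tmul, Y.star_inner, Y.inner_left, X.star_inner]

theorem tensorForm_nonneg (z : X.carrier ⊗[ℂ] Y.carrier) : 0 ≤ tensorForm X Y z z := by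
  obtain ⟨S, hS⟩ := TensorProduct.exists_finset z
  let e := S.equivFin
  set k := S.card
  let x : Fin k → X.carrier := fun i => (e.symm i).1.1
  let y : Fin k → Y.carrier := fun i => (e.symm i).1.2
  have hz : z = ∑ i, x i ⊗ₜ[ℂ] y i := by
    rw [hS, ← Finset.sum_coe_sort S]
    exact (Equiv.sum_comp e.symm (fun p : S => p.1.1 ⊗ₜ[ℂ] p.1.2)).symm
  obtain ⟨C, hC⟩ := exists_eq_star_mul_self _ (X.gram_nonneg x)
  have hC' : ∀ i j, X.inner (x i) (x j) = ∑ l, star (C l i) * C l j := fun i j => by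
    have := congrArg (fun M : CStarMatrix (Fin k) (Fin k) B => M i j) hC
    simp only [CStarMatrix.mul_apply, CStarMatrix.star_apply] at this
    exact this
  have : tensorForm X Y z z
      = ∑ l, Y.inner (∑ i, Y.left (C l i) (y i)) (∑ i, Y.left (C l i) (y i)) := by
    rw [hz]
    simp only [map_sum, LinearMap.sum_apply, tensorForm_tmul, hC', Y.inner_left, Y.left_mul]
    rw [Finset.sum_comm, Finset.sum_comm' (t' := Finset.univ) (s' := fun _ => Finset.univ)
      (by simp)]
    rw [eq_comm, Finset.sum_comm]
    refine Finset.sum_congr rfl fun i _ => ?_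
    rw [Finset.sum_comm]
  rw [this]
  exact Finset.sum_nonneg fun l _ => Y.inner_self_nonneg _

theorem tensorForm_right (b : B) (z w : X.carrier ⊗[ℂ] Y.carrier) :
    tensorForm X Y z ((Y.right b).lTensor X.carrier w) = tensorForm X Y z w * b := by
  induction z with
  | zero => simp
  | add z z' hz hz' => simp [hz, hz', add_mul]
  | tmul x y =>
    induction w with
    | zero => simp
    | add w w' hw hw' => simp only [map_add, hw, hw', add_mul]
    | tmul x' y' =>
      rw [LinearMap.lTensor_tmul, tensorForm_tmul, tensorForm_tmul, Y.left_right, Y.inner_right]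

theorem tensorForm_left (b : B) (z w : X.carrier ⊗[ℂ] Y.carrier) :
    tensorForm X Y ((X.left b).rTensor Y.carrier z) w
      = tensorForm X Y z ((X.left (star b)).rTensor Y.carrier w) := by
  induction z with
  | zero => simp
  | add z z' hz hz' => simp [hz, hz']
  | tmul x y =>
    induction w with
    | zero => simp
    | add w w' hw hw' => simp only [map_add, hw, hw']
    | tmul x' y' => simp [X.inner_left]

/-- The null space of the form (by Cauchy-Schwarz, the set of all `z` with `⟨z | z⟩ = 0`). -/
def tensorNull : Submodule ℂ (X.carrier ⊗[ℂ] Y.carrier) := LinearMap.ker (tensorForm X Y)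

theorem mem_tensorNull {z : X.carrier ⊗[ℂ] Y.carrier} :
    z ∈ tensorNull X Y ↔ ∀ w, tensorForm X Y z w = 0 := by
  rw [tensorNull, LinearMap.mem_ker, LinearMap.ext_iff]; rfl

theorem mem_tensorNull' {z : X.carrier ⊗[ℂ] Y.carrier} :
    z ∈ tensorNull X Y ↔ ∀ w, tensorForm X Y w z = 0 := by
  rw [mem_tensorNull]
  exact forall_congr' fun w => by rw [← star_tensorForm, star_eq_zero]

theorem mem_tensorNull_iff_self {z : X.carrier ⊗[ℂ] Y.carrier} :
    z ∈ tensorNull X Y ↔ tensorForm X Y z z = 0 := by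
  rw [mem_tensorNull]
  exact ⟨fun h => h z, fun h w => form_eq_zero (tensorForm X Y)
    (fun b => (Y.right b).lTensor X.carrier) (tensorForm_right X Y) (star_tensorForm X Y)
    (tensorForm_nonneg X Y) z w h⟩

/-- The underlying space of `X ⊗_B Y`: the quotient by null vectors.  It is finite-dimensional,
hence complete. -/
abbrev TensorCarrier : Type u := (X.carrier ⊗[ℂ] Y.carrier) ⧸ tensorNull X Y

theorem tensorNull_left (b : B) :
    tensorNull X Y ≤ (tensorNull X Y).comap ((X.left b).rTensor Y.carrier) := fun z hz => by
  rw [Submodule.mem_comap, mem_tensorNull]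
  intro w
  rw [tensorForm_left]
  exact (mem_tensorNull X Y).mp hz _

theorem tensorNull_right (b : B) :
    tensorNull X Y ≤ (tensorNull X Y).comap ((Y.right b).lTensor X.carrier) := fun z hz => by
  rw [Submodule.mem_comap, mem_tensorNull']
  intro w
  rw [tensorForm_right, (mem_tensorNull' X Y).mp hz, zero_mul]

def tensorLeft : B →ₗ[ℂ] TensorCarrier X Y →ₗ[ℂ] TensorCarrier X Y where
  toFun b := Submodule.mapQ _ _ ((X.left b).rTensor Y.carrier) (tensorNull_left X Y b)
  map_add' b c := by
    apply Submodule.linearMap_qext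
    ext; simp
  map_smul' a b := by
    apply Submodule.linearMap_qext
    ext; simp

def tensorRight : B →ₗ[ℂ] TensorCarrier X Y →ₗ[ℂ] TensorCarrier X Y where
  toFun b := Submodule.mapQ _ _ ((Y.right b).lTensor X.carrier) (tensorNull_right X Y b)
  map_add' b c := by
    apply Submodule.linearMap_qext
    ext; simp
  map_smul' a b := by
    apply Submodule.linearMap_qext
    ext; simp

def tensorInner : TensorCarrier X Y →ₗ⋆[ℂ] TensorCarrier X Y →ₗ[ℂ] B :=
  (tensorNull X Y).liftQ
    { toFun := fun z => (tensorNull X Y).liftQ (tensorForm X Y z)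
        fun _ hw => (mem_tensorNull' X Y).mp hw z
      map_add' := fun _ _ => by
        apply Submodule.linearMap_qext
        ext; simp; rfl
      map_smul' := fun _ _ => by
        apply Submodule.linearMap_qext
        ext; simp; rfl }
    fun z hz => by
      rw [LinearMap.mem_ker]
      apply Submodule.linearMap_qext
      ext w w'
      exact (mem_tensorNull X Y).mp hz _

theorem tensorInner_mk (z w : X.carrier ⊗[ℂ] Y.carrier) :
    tensorInner X Y (Submodule.Quotient.mk z) (Submodule.Quotient.mk w) = tensorForm X Y z w := rfl

/-- The internal tensor product `X ⊗_B Y`. -/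
def tensor : Correspondence B where
  carrier := TensorCarrier X Y
  left := tensorLeft X Y
  right := tensorRight X Y
  inner := tensorInner X Y
  left_mul b c z := by
    obtain ⟨z, rfl⟩ := Submodule.Quotient.mk_surjective _ z
    refine congrArg Submodule.Quotient.mk ?_
    induction z with
    | zero => simp
    | add z w hz hw => simp only [map_add, hz, hw]
    | tmul x y => simp [X.left_mul]
  right_mul b c z := by
    obtain ⟨z, rfl⟩ := Submodule.Quotient.mk_surjective _ z
    refine congrArg Submodule.Quotient.mk ?_
    induction z with
    | zero => simp
    | add z w hz hw => simp only [map_add, hz, hw]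
    | tmul x y => simp [Y.right_mul]
  right_one z := by
    obtain ⟨z, rfl⟩ := Submodule.Quotient.mk_surjective _ z
    refine congrArg Submodule.Quotient.mk ?_
    induction z with
    | zero => simp
    | add z w hz hw => simp only [map_add, hz, hw]
    | tmul x y => simp [Y.right_one]
  star_inner z w := by
    obtain ⟨z, rfl⟩ := Submodule.Quotient.mk_surjective _ z
    obtain ⟨w, rfl⟩ := Submodule.Quotient.mk_surjective _ w
    exact star_tensorForm X Y z w
  inner_right b z w := by
    obtain ⟨z, rfl⟩ := Submodule.Quotient.mk_surjective _ z
    obtain ⟨w, rfl⟩ := Submodule.Quotient.mk_surjective _ w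
    exact tensorForm_right X Y b z w
  inner_left b z w := by
    obtain ⟨z, rfl⟩ := Submodule.Quotient.mk_surjective _ z
    obtain ⟨w, rfl⟩ := Submodule.Quotient.mk_surjective _ w
    exact tensorForm_left X Y b z w
  inner_self_nonneg z := by
    obtain ⟨z, rfl⟩ := Submodule.Quotient.mk_surjective _ z
    exact tensorForm_nonneg X Y z
  eq_zero_of_inner_self z h := by
    obtain ⟨z, rfl⟩ := Submodule.Quotient.mk_surjective _ z
    rw [Submodule.Quotient.mk_eq_zero]
    exact (mem_tensorNull_iff_self X Y).mpr h

/-- The elementary tensor `x ⊗ y` in `X ⊗_B Y`. -/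
def tprod {X Y : Correspondence B} (x : X.carrier) (y : Y.carrier) : (tensor X Y).carrier :=
  (Submodule.Quotient.mk (x ⊗ₜ[ℂ] y) : TensorCarrier X Y)

end Tensor

/-- `B` as a correspondence over itself, with `⟨x | y⟩ = x* y`. -/
def self (B : Type u) [CStarAlgebra B] [PartialOrder B] [StarOrderedRing B]
    [FiniteDimensional ℂ B] : Correspondence B where
  carrier := B
  left := LinearMap.mul ℂ B
  right := (LinearMap.mul ℂ B).flip
  inner := LinearMap.mk₂'ₛₗ (starRingEnd ℂ) (RingHom.id ℂ) (fun x y => star x * y)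
    (by intros; simp [add_mul]) (by intros; simp) (by intros; simp [mul_add])
    (by intros; simp)
  left_mul b c x := by simp [mul_assoc]
  right_mul b c x := by simp [mul_assoc]
  right_one x := by simp
  star_inner x y := by simp
  inner_right b x y := by simp [mul_assoc]
  inner_left b x y := by simp [mul_assoc]
  inner_self_nonneg x := star_mul_self_nonneg x
  eq_zero_of_inner_self x h := CStarRing.star_mul_self_eq_zero_iff _ |>.mp h

/-- The subcorrespondence on a subspace that is invariant under both actions. -/
def sub (X : Correspondence B) (V : Submodule ℂ X.carrier)
    (hl : ∀ b, ∀ x ∈ V, X.left b x ∈ V) (hr : ∀ b, ∀ x ∈ V, X.right b x ∈ V) :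
    Correspondence B where
  carrier := V
  left :=
    { toFun := fun b => (X.left b).restrict (hl b)
      map_add' := fun _ _ => by ext; simp
      map_smul' := fun _ _ => by ext; simp }
  right :=
    { toFun := fun b => (X.right b).restrict (hr b)
      map_add' := fun _ _ => by ext; simp
      map_smul' := fun _ _ => by ext; simp }
  inner := LinearMap.mk₂'ₛₗ (starRingEnd ℂ) (RingHom.id ℂ)
    (fun x y => X.inner (x : X.carrier) (y : X.carrier))
    (by intros; simp) (by intros; simp) (by intros; simp) (by intros; simp)
  left_mul b c x := Subtype.ext (X.left_mul b c x)
  right_mul b c x := Subtype.ext (X.right_mul b c x)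
  right_one x := Subtype.ext (X.right_one x)
  star_inner x y := X.star_inner x y
  inner_right b x y := X.inner_right b x y
  inner_left b x y := X.inner_left b x y
  inner_self_nonneg x := X.inner_self_nonneg x
  eq_zero_of_inner_self x h := Subtype.ext (X.eq_zero_of_inner_self x h)

/-- The tensor powers `X^{⊗m}` over `B`: `X^{⊗0} = B`, `X^{⊗1} = X`,
`X^{⊗(m+2)} = X ⊗_B X^{⊗(m+1)}`. -/
def tpow [FiniteDimensional ℂ B] (X : Correspondence B) : ℕ → Correspondence B
  | 0 => self B
  | 1 => X
  | m + 2 => tensor X (tpow X (m + 1))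

/-- The vector `ξ ⊗ η ⊗ ⋯ ⊗ η` of `X^{⊗(k+1)}`. -/
def powTensor [FiniteDimensional ℂ B] (X : Correspondence B) (ξ η : X.carrier) :
    (k : ℕ) → (X.tpow (k + 1)).carrier
  | 0 => ξ
  | k + 1 => tprod ξ (powTensor X η η k)

/-- The operator `θ_{ξ,η}(μ) = ξ · ⟨η | μ⟩`. -/
def rankOne (X : Correspondence B) (ξ η : X.carrier) : X.carrier →ₗ[ℂ] X.carrier :=
  X.right.flip ξ ∘ₗ X.inner η

/-- `K(X)`, the span of the rank-one operators (closed, since `X` is finite-dimensional). -/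
def compacts (X : Correspondence B) : Submodule ℂ (X.carrier →ₗ[ℂ] X.carrier) :=
  Submodule.span ℂ {T | ∃ ξ η, T = X.rankOne ξ η}

/-- The Katsura ideal `J_X = φ⁻¹(K(X)) ∩ (ker φ)^⊥`, for the left action `φ`. -/
def katsuraIdeal (X : Correspondence B) : Set B :=
  {y | X.left y ∈ X.compacts ∧ ∀ x, X.left x = 0 → x * y = 0}

/-- Toeplitz representations `(π, t)` of `X` in a C*-algebra `D`. -/
structure IsToeplitz (X : Correspondence B) {D : Type*} [NonUnitalCStarAlgebra D]
    (π : B →⋆ₙₐ[ℂ] D) (t : X.carrier →ₗ[ℂ] D) : Prop where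
  left : ∀ b ξ, π b * t ξ = t (X.left b ξ)
  inner : ∀ ξ η, star (t ξ) * t η = π (X.inner ξ η)

/-- Covariant representations: `π(b) = ψ_t(φ(b))` for `b ∈ J_X`, where `ψ_t : K(X) → D` is the
linear map determined by `ψ_t(θ_{ξ,η}) = t(ξ) t(η)*`; an element of `K(X)` is a finite sum of
operators `θ_{ξ,η}`. -/
structure IsCovariant (X : Correspondence B) {D : Type*} [NonUnitalCStarAlgebra D]
    (π : B →⋆ₙₐ[ℂ] D) (t : X.carrier →ₗ[ℂ] D) : Prop extends X.IsToeplitz π t where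
  covariant : ∀ b ∈ X.katsuraIdeal, ∀ (k : ℕ) (ξ η : Fin k → X.carrier),
    X.left b = ∑ i, X.rankOne (ξ i) (η i) → π b = ∑ i, t (ξ i) * star (t (η i))

/-- The tensor product `x ⊗ y ↦ t(x) s(y)` of Toeplitz representations `(π, t)` of `X` and
`(π, s)` of `Y`. -/
def toeplitzTensor {X Y : Correspondence B} {D : Type*} [NonUnitalCStarAlgebra D]
    {π : B →⋆ₙₐ[ℂ] D} (t : {t : X.carrier →ₗ[ℂ] D // X.IsToeplitz π t})
    (s : {s : Y.carrier →ₗ[ℂ] D // Y.IsToeplitz π s}) :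
    {r : (tensor X Y).carrier →ₗ[ℂ] D // (tensor X Y).IsToeplitz π r} := by
  let r₀ : X.carrier ⊗[ℂ] Y.carrier →ₗ[ℂ] D :=
    TensorProduct.lift ((LinearMap.mul ℂ D).compl₁₂ t.1 s.1)
  have h₀ : ∀ z w, star (r₀ z) * r₀ w = π (tensorForm X Y z w) := by
    intro z w
    induction z with
    | zero => simp
    | add z z' hz hz' => simp [hz, hz', add_mul]
    | tmul x y =>
      induction w with
      | zero => simp
      | add w w' hw hw' => simp only [map_add, hw, hw', mul_add]
      | tmul x' y' =>
        rw [tensorForm_tmul, ← s.2.inner, ← s.2.left, ← t.2.inner]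
        simp [r₀, mul_assoc]
  refine ⟨(tensorNull X Y).liftQ r₀ fun z hz => ?_, ⟨fun b z => ?_, fun z w => ?_⟩⟩
  · rw [LinearMap.mem_ker, ← CStarRing.star_mul_self_eq_zero_iff, h₀,
      (mem_tensorNull X Y).mp hz, map_zero]
  · obtain ⟨z, rfl⟩ := Submodule.Quotient.mk_surjective _ z
    change π b * r₀ z = r₀ ((X.left b).rTensor Y.carrier z)
    induction z with
    | zero => simp
    | add z z' hz hz' => simp only [map_add, mul_add, hz, hz']
    | tmul x y => simp [r₀, ← t.2.left, mul_assoc]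
  · obtain ⟨z, rfl⟩ := Submodule.Quotient.mk_surjective _ z
    obtain ⟨w, rfl⟩ := Submodule.Quotient.mk_surjective _ w
    exact h₀ z w

theorem toeplitzTensor_tprod {X Y : Correspondence B} {D : Type*} [NonUnitalCStarAlgebra D]
    {π : B →⋆ₙₐ[ℂ] D} (t : {t : X.carrier →ₗ[ℂ] D // X.IsToeplitz π t})
    (s : {s : Y.carrier →ₗ[ℂ] D // Y.IsToeplitz π s}) (x : X.carrier) (y : Y.carrier) :
    (toeplitzTensor t s).1 (tprod x y) = t.1 x * s.1 y := rfl

/-- The maps `t^m : X^{⊗m} → D`, with `t^0 = π`, `t^1 = t` and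
`t^(m+2)(ξ ⊗ η) = t(ξ) t^(m+1)(η)`. -/
def toeplitzPow [FiniteDimensional ℂ B] (X : Correspondence B) {D : Type*}
    [NonUnitalCStarAlgebra D] {π : B →⋆ₙₐ[ℂ] D}
    (t : {t : X.carrier →ₗ[ℂ] D // X.IsToeplitz π t}) :
    (m : ℕ) → {r : (X.tpow m).carrier →ₗ[ℂ] D // (X.tpow m).IsToeplitz π r}
  | 0 => ⟨{ toFun := π, map_add' := map_add π, map_smul' := map_smul π },
      ⟨fun b (x : B) => (map_mul π b x).symm, fun (x y : B) => by
        change star (π x) * π y = π (star x * y)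
        rw [map_mul, map_star]⟩⟩
  | 1 => t
  | m + 2 => toeplitzTensor t (toeplitzPow X t (m + 1))

section CuntzPimsner

variable (X : Correspondence B)

/-- A covariant representation of `X` in some C*-algebra. -/
structure CovariantRep where
  D : Type u
  [cstar : NonUnitalCStarAlgebra D]
  π : B →⋆ₙₐ[ℂ] D
  t : X.carrier →ₗ[ℂ] D
  isCovariant : X.IsCovariant π t

attribute [instance] CovariantRep.cstar

/-- The `ℓ^∞`-product of the C*-algebras of all covariant representations. -/
abbrev RepProduct : Type (u + 1) := lp (fun R : CovariantRep X => R.D) ∞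

def prodπ : B →⋆ₙₐ[ℂ] RepProduct X where
  toFun b := ⟨fun R => R.π b, memℓp_infty ⟨‖b‖, by
    rintro _ ⟨R, rfl⟩
    exact NonUnitalStarAlgHom.norm_apply_le R.π b⟩⟩
  map_smul' a b := by ext R; exact map_smul R.π a b
  map_zero' := by ext R; exact map_zero R.π
  map_add' a b := by ext R; exact map_add R.π a b
  map_mul' a b := by ext R; exact map_mul R.π a b
  map_star' a := by ext R; exact map_star R.π a

def prodt : X.carrier →ₗ[ℂ] RepProduct X where
  toFun x := ⟨fun R => R.t x, memℓp_infty ⟨X.norm x, by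
    rintro _ ⟨R, rfl⟩
    refine Real.le_sqrt_of_sq_le ?_
    rw [sq, ← CStarRing.norm_star_mul_self, R.isCovariant.inner]
    exact NonUnitalStarAlgHom.norm_apply_le R.π _⟩⟩
  map_add' a b := by ext R; exact map_add R.t a b
  map_smul' a b := by ext R; exact map_smul R.t a b

def cuntzPimsnerSubalgebra : NonUnitalStarSubalgebra ℂ (RepProduct X) :=
  (NonUnitalStarAlgebra.adjoin ℂ
    (Set.range (prodπ X) ∪ Set.range (prodt X))).topologicalClosure

/-- The Cuntz-Pimsner algebra `O_X`: the C*-algebra generated by the universal covariant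
representation, which is the product of all covariant representations of `X`.  Restricting these
to one universe loses nothing: `B` and `X` are finite-dimensional in every use, so a covariant
representation generates a separable C*-algebra, which has a copy in every universe. -/
def CuntzPimsner : Type (u + 1) := cuntzPimsnerSubalgebra X

instance : NonUnitalCStarAlgebra (CuntzPimsner X) :=
  NonUnitalStarSubalgebra.nonUnitalCStarAlgebra (cuntzPimsnerSubalgebra X)
    (h_closed := NonUnitalStarSubalgebra.isClosed_topologicalClosure _)

theorem prodπ_mem (b : B) : prodπ X b ∈ cuntzPimsnerSubalgebra X :=
  NonUnitalStarSubalgebra.le_topologicalClosure _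
    (NonUnitalStarAlgebra.subset_adjoin ℂ _ (Or.inl ⟨b, rfl⟩))

theorem prodt_mem (x : X.carrier) : prodt X x ∈ cuntzPimsnerSubalgebra X :=
  NonUnitalStarSubalgebra.le_topologicalClosure _
    (NonUnitalStarAlgebra.subset_adjoin ℂ _ (Or.inr ⟨x, rfl⟩))

/-- The universal `π_X : B → O_X`. -/
def univπ : B →⋆ₙₐ[ℂ] CuntzPimsner X :=
  NonUnitalStarAlgHom.codRestrict (prodπ X) (cuntzPimsnerSubalgebra X) (prodπ_mem X)

/-- The universal `t_X : X → O_X`. -/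
def univt : X.carrier →ₗ[ℂ] CuntzPimsner X :=
  LinearMap.codRestrict (cuntzPimsnerSubalgebra X).toSubmodule (prodt X) (prodt_mem X)

/-- Evaluation of `O_X` at a covariant representation. -/
def evalRep (R : CovariantRep X) : CuntzPimsner X →⋆ₙₐ[ℂ] R.D where
  toFun a := a.1 R
  map_smul' _ _ := rfl
  map_zero' := rfl
  map_add' _ _ := rfl
  map_mul' _ _ := rfl
  map_star' _ := rfl

theorem cuntzPimsner_ext {a b : CuntzPimsner X} (h : ∀ R, evalRep X R a = evalRep X R b) :
    a = b :=
  Subtype.ext (lp.ext (funext h))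

theorem univ_isCovariant : X.IsCovariant (univπ X) (univt X) where
  left b ξ := cuntzPimsner_ext X fun R => by
    rw [map_mul]; exact R.isCovariant.left b ξ
  inner ξ η := cuntzPimsner_ext X fun R => by
    rw [map_mul, map_star]; exact R.isCovariant.inner ξ η
  covariant b hb k ξ η h := cuntzPimsner_ext X fun R => by
    rw [map_sum]
    simp only [map_mul, map_star]
    exact R.isCovariant.covariant b hb k ξ η h

/-- The universal property of `(O_X, π_X, t_X)`. -/
theorem univ_universal (R : CovariantRep X) : ∃ ρ : CuntzPimsner X →⋆ₙₐ[ℂ] R.D,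
    (∀ b, ρ (univπ X b) = R.π b) ∧ ∀ x, ρ (univt X x) = R.t x :=
  ⟨evalRep X R, fun _ => rfl, fun _ => rfl⟩

variable [FiniteDimensional ℂ B]

/-- The maps `t_X^m : X^{⊗m} → O_X`. -/
def univtPow (m : ℕ) : (X.tpow m).carrier →ₗ[ℂ] CuntzPimsner X :=
  (X.toeplitzPow ⟨univt X, (univ_isCovariant X).toIsToeplitz⟩ m).1

/-- `ξ ∈ X^{⊗m}` is non-returning if `t^m(ξ)* t^n(η) t^m(ξ) = 0` in `O_X` whenever `0 < n < m`
and `η ∈ X^{⊗n}`. -/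
def IsNonReturning {m : ℕ} (ξ : (X.tpow m).carrier) : Prop :=
  ∀ n, 0 < n → n < m → ∀ η : (X.tpow n).carrier,
    star (X.univtPow m ξ) * X.univtPow n η * X.univtPow m ξ = 0

def ConditionS : Prop :=
  ∀ x : B, 0 ≤ x → ∀ n : ℕ, ∀ ε : ℝ, 0 < ε → ∃ m, n < m ∧ ∃ ξ : (X.tpow m).carrier,
    (X.tpow m).norm ξ = 1 ∧ X.IsNonReturning ξ ∧
      ‖x‖ < ‖(X.tpow m).inner ξ ((X.tpow m).left x ξ)‖ + ε

end CuntzPimsner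

end Correspondence

section QuantumGraph

open scoped CStarAlgebra

/-- A faithful state on `B`. -/
structure FaithfulState (B : Type u) [CStarAlgebra B] [PartialOrder B] [StarOrderedRing B] where
  toPositive : B →ₚ[ℂ] ℂ
  map_one : toPositive 1 = 1
  faithful : ∀ x, toPositive (star x * x) = 0 → x = 0

variable {B : Type u} [CStarAlgebra B] [PartialOrder B] [StarOrderedRing B]

namespace FaithfulState

instance : CoeFun (FaithfulState B) (fun _ => B → ℂ) := ⟨fun ψ => ψ.toPositive⟩

variable (ψ : FaithfulState B)

/-- `ψ` is tracial if `ψ(xy) = ψ(yx)`. -/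
def IsTracial : Prop := ∀ x y, ψ (x * y) = ψ (y * x)

/-- The space `L²(B, ψ)`: `B` with the inner product `⟨x, y⟩ = ψ(x* y)`. -/
def L2 (_ψ : FaithfulState B) : Type u := B

instance : AddCommGroup ψ.L2 := inferInstanceAs (AddCommGroup B)
instance : Module ℂ ψ.L2 := inferInstanceAs (Module ℂ B)
instance [h : FiniteDimensional ℂ B] : FiniteDimensional ℂ ψ.L2 := h

/-- The identity map `B → L²(B, ψ)`. -/
def toL2 : B ≃ₗ[ℂ] ψ.L2 := LinearEquiv.refl ℂ B

theorem star_apply_star_mul (x y : B) : star (ψ (star y * x)) = ψ (star x * y) := by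
  have := map_star ψ.toPositive (star y * x)
  rw [star_mul, star_star] at this
  exact this.symm

@[reducible] def innerCore : InnerProductSpace.Core ℂ ψ.L2 where
  inner x y := ψ (star (ψ.toL2.symm x) * ψ.toL2.symm y)
  conj_inner_symm x y := ψ.star_apply_star_mul _ _
  re_inner_nonneg x := by
    have := ψ.toPositive.map_nonneg (star_mul_self_nonneg (ψ.toL2.symm x))
    exact (Complex.le_def.mp this).1
  add_left x y z := by simp [add_mul]
  smul_left x y r := by simp
  definite x h := (LinearEquiv.map_eq_zero_iff _).mp (ψ.faithful _ h)

instance : NormedAddCommGroup ψ.L2 := ψ.innerCore.toNormedAddCommGroup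
instance : InnerProductSpace ℂ ψ.L2 := InnerProductSpace.ofCore ψ.innerCore.toCore

theorem inner_toL2 (x y : B) : inner ℂ (ψ.toL2 x) (ψ.toL2 y) = ψ (star x * y) := rfl

/-- The multiplication `m : L²(B ⊗ B, ψ ⊗ ψ) → L²(B, ψ)`. -/
def mulL2 : ψ.L2 ⊗[ℂ] ψ.L2 →ₗ[ℂ] ψ.L2 :=
  ψ.toL2.toLinearMap ∘ₗ LinearMap.mul' ℂ B ∘ₗ (TensorProduct.congr ψ.toL2 ψ.toL2).symm.toLinearMap

section

variable [FiniteDimensional ℂ B]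

/-- The adjoint `m* : B → B ⊗ B` of the multiplication with respect to `ψ`. -/
def comul : B →ₗ[ℂ] B ⊗[ℂ] B :=
  (TensorProduct.congr ψ.toL2 ψ.toL2).symm.toLinearMap ∘ₗ LinearMap.adjoint ψ.mulL2 ∘ₗ
    ψ.toL2.toLinearMap

/-- `ψ` is a `δ`-form if `m m* = δ² id`. -/
def IsDeltaForm (δ : ℝ) : Prop :=
  0 < δ ∧ LinearMap.mul' ℂ B ∘ₗ ψ.comul = ((δ : ℂ) ^ 2) • LinearMap.id

end

/-- The form `⟨x ⊗ y | x' ⊗ y'⟩ = y* ψ(x* x') y'` on `B ⊗ B`. -/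
def tensorInner : B ⊗[ℂ] B →ₗ⋆[ℂ] B ⊗[ℂ] B →ₗ[ℂ] B :=
  TensorProduct.lift <| LinearMap.mk₂'ₛₗ (starRingEnd ℂ) (starRingEnd ℂ)
    (fun x y => TensorProduct.lift <| LinearMap.mk₂ ℂ
      (fun x' y' => ψ (star x * x') • (star y * y'))
      (by intros; simp [mul_add, add_smul]) (by intros; simp [smul_smul])
      (by intros; simp [mul_add])
      (by intros; rw [mul_smul_comm, smul_comm]))
    (by intros; ext; simp [add_mul, add_smul]) (by intros; ext; simp [smul_smul])
    (by intros; ext; simp [add_mul])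
    (by intros; ext; simp [smul_smul, mul_comm])

@[simp] theorem tensorInner_tmul (x y x' y' : B) :
    ψ.tensorInner (x ⊗ₜ y) (x' ⊗ₜ y') = ψ (star x * x') • (star y * y') := rfl

/-- The map `x ⊗ y ↦ ⟨e, x⟩ y`. -/
def coord (e : ψ.L2) : B ⊗[ℂ] B →ₗ[ℂ] B :=
  TensorProduct.lift (LinearMap.lsmul ℂ B ∘ₗ
    ((innerSL ℂ e).toLinearMap ∘ₗ ψ.toL2.toLinearMap))

theorem coord_tmul (e : ψ.L2) (x y : B) :
    ψ.coord e (x ⊗ₜ y) = (inner ℂ e (ψ.toL2 x) : ℂ) • y := rfl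

variable [FiniteDimensional ℂ B]

theorem tensorInner_eq (z w : B ⊗[ℂ] B) : ψ.tensorInner z w =
    ∑ i, star (ψ.coord (stdOrthonormalBasis ℂ ψ.L2 i) z) *
      ψ.coord (stdOrthonormalBasis ℂ ψ.L2 i) w := by
  induction z with
  | zero => simp
  | add z z' hz hz' => simp [hz, hz', add_mul, Finset.sum_add_distrib]
  | tmul x y =>
    induction w with
    | zero => simp
    | add w w' hw hw' => simp only [map_add, hw, hw', mul_add, Finset.sum_add_distrib]
    | tmul x' y' =>
      rw [tensorInner_tmul, ← inner_toL2,
        ← (stdOrthonormalBasis ℂ ψ.L2).sum_inner_mul_inner, Finset.sum_smul]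
      refine Finset.sum_congr rfl fun i _ => ?_
      rw [coord_tmul, coord_tmul, star_smul, smul_mul_smul_comm]
      congr 2
      exact (inner_conj_symm _ _).symm

theorem sum_coord (z : B ⊗[ℂ] B) :
    z = ∑ i, (ψ.toL2.symm (stdOrthonormalBasis ℂ ψ.L2 i)) ⊗ₜ[ℂ]
      ψ.coord (stdOrthonormalBasis ℂ ψ.L2 i) z := by
  induction z with
  | zero => simp
  | add z z' hz hz' =>
    simp only [map_add, TensorProduct.tmul_add, Finset.sum_add_distrib]
    rw [← hz, ← hz']
  | tmul x y =>
    simp only [coord_tmul, ← TensorProduct.smul_tmul, ← map_smul]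
    rw [← TensorProduct.sum_tmul, ← map_sum, (stdOrthonormalBasis ℂ ψ.L2).sum_repr']
    simp

/-- The correspondence `B ⊗_ψ B`. -/
def tensorCorrespondence : Correspondence B where
  carrier := B ⊗[ℂ] B
  left := LinearMap.rTensorHom B ∘ₗ LinearMap.mul ℂ B
  right := LinearMap.lTensorHom B ∘ₗ (LinearMap.mul ℂ B).flip
  inner := ψ.tensorInner
  left_mul b c z := by
    induction z with
    | zero => simp
    | add z w hz hw => simp only [map_add, hz, hw]
    | tmul x y => simp [mul_assoc]
  right_mul b c z := by
    induction z with
    | zero => simp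
    | add z w hz hw => simp only [map_add, hz, hw]
    | tmul x y => simp [mul_assoc]
  right_one z := by
    induction z with
    | zero => simp
    | add z w hz hw => simp only [map_add, hz, hw]
    | tmul x y => simp
  star_inner z w := by simp [tensorInner_eq]
  inner_right b z w := by
    induction z with
    | zero => simp
    | add z z' hz hz' => simp only [map_add, LinearMap.add_apply, hz, hz', add_mul]
    | tmul x y =>
      induction w with
      | zero => simp
      | add w w' hw hw' => simp only [map_add, hw, hw', add_mul]
      | tmul x' y' => simp [mul_assoc]
  inner_left b z w := by
    induction z with
    | zero => simp
    | add z z' hz hz' => simp only [map_add, LinearMap.add_apply, hz, hz']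
    | tmul x y =>
      induction w with
      | zero => simp
      | add w w' hw hw' => simp only [map_add, hw, hw']
      | tmul x' y' => simp [mul_assoc]
  inner_self_nonneg z := by
    rw [tensorInner_eq]
    exact Finset.sum_nonneg fun i _ => star_mul_self_nonneg _
  eq_zero_of_inner_self z h := by
    rw [tensorInner_eq, Finset.sum_eq_zero_iff_of_nonneg
      (fun i _ => star_mul_self_nonneg _)] at h
    rw [ψ.sum_coord z]
    refine Finset.sum_eq_zero fun i hi => ?_
    rw [CStarRing.star_mul_self_eq_zero_iff _ |>.mp (h i hi), TensorProduct.tmul_zero]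

end FaithfulState

variable [FiniteDimensional ℂ B]

/-- A finite quantum graph `(B, ψ, A)`: `ψ` is a `δ`-form and `A` is completely positive and
quantum Schur idempotent, `m (A ⊗ A) m* = δ² A`. -/
structure QuantumGraph (B : Type u) [CStarAlgebra B] [PartialOrder B] [StarOrderedRing B]
    [FiniteDimensional ℂ B] where
  ψ : FaithfulState B
  δ : ℝ
  isDeltaForm : ψ.IsDeltaForm δ
  A : B →CP B
  schur : LinearMap.mul' ℂ B ∘ₗ TensorProduct.map A.toLinearMap A.toLinearMap ∘ₗ ψ.comul
    = ((δ : ℂ) ^ 2) • A.toLinearMap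

namespace QuantumGraph

variable (G : QuantumGraph B)

/-- `ε_G = δ⁻² (id ⊗ A) m*(1)`. -/
def edgeElement : G.ψ.tensorCorrespondence.carrier :=
  (((G.δ : ℂ) ^ 2)⁻¹ • (G.A.toLinearMap.lTensor B (G.ψ.comul 1)) : B ⊗[ℂ] B)

/-- The subspace `span {x · ε_G · y : x, y ∈ B}` of `B ⊗_ψ B`. -/
def edgeSubspace : Submodule ℂ G.ψ.tensorCorrespondence.carrier :=
  Submodule.span ℂ {z | ∃ x y : B, z = G.ψ.tensorCorrespondence.right y
    (G.ψ.tensorCorrespondence.left x G.edgeElement)}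

theorem left_mem_edgeSubspace (b : B) (z : G.ψ.tensorCorrespondence.carrier)
    (hz : z ∈ G.edgeSubspace) : G.ψ.tensorCorrespondence.left b z ∈ G.edgeSubspace := by
  refine Submodule.span_le (p := G.edgeSubspace.comap (G.ψ.tensorCorrespondence.left b)) |>.mpr
    ?_ hz
  rintro _ ⟨x, y, rfl⟩
  refine Submodule.subset_span ⟨b * x, y, ?_⟩
  rw [Correspondence.left_right, Correspondence.left_mul]

theorem right_mem_edgeSubspace (b : B) (z : G.ψ.tensorCorrespondence.carrier)
    (hz : z ∈ G.edgeSubspace) : G.ψ.tensorCorrespondence.right b z ∈ G.edgeSubspace := by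
  refine Submodule.span_le (p := G.edgeSubspace.comap (G.ψ.tensorCorrespondence.right b)) |>.mpr
    ?_ hz
  rintro _ ⟨x, y, rfl⟩
  exact Submodule.subset_span ⟨x, y * b, (Correspondence.right_mul _ y b _).symm⟩

/-- The quantum edge correspondence `E_G`. -/
def edgeCorrespondence : Correspondence B :=
  G.ψ.tensorCorrespondence.sub G.edgeSubspace G.left_mem_edgeSubspace G.right_mem_edgeSubspace

/-- `ε_G` as a vector of `E_G`. -/
def edgeVector : G.edgeCorrespondence.carrier :=
  ⟨G.edgeElement, Submodule.subset_span ⟨1, 1, by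
    have h : G.ψ.tensorCorrespondence.left 1 G.edgeElement = G.edgeElement := by
      change LinearMap.rTensor B (LinearMap.mul ℂ B 1) _ = _
      rw [show LinearMap.mul ℂ B 1 = LinearMap.id from by ext; simp, LinearMap.rTensor_id]
      rfl
    rw [h, Correspondence.right_one]⟩⟩

/-- The vector `(p · ε_G · q) ⊗ (ε_G · q) ⊗ ⋯ ⊗ (ε_G · q)` of `E_G^{⊗(k+1)}`. -/
def pathVector (p q : B) (k : ℕ) : (G.edgeCorrespondence.tpow (k + 1)).carrier :=
  G.edgeCorrespondence.powTensor
    (G.edgeCorrespondence.right q (G.edgeCorrespondence.left p G.edgeVector))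
    (G.edgeCorrespondence.right q G.edgeVector) k

end QuantumGraph

/-- `B = M_n(ℂ) ⊕ M_n(ℂ) ⊕ M_n(ℂ)`, with the C*-norm and the C*-order. -/
abbrev ThreeBlocks (n : ℕ) : Type := Fin 3 → Matrix (Fin n) (Fin n) ℂ

/-- `ψ` is a tracial `δ`-form, and
`A(x₁ ⊕ x₂ ⊕ x₃) = (x₁ + x₂ + x₃) ⊕ (x₁ + x₂) ⊕ 0`. -/
def IsThreeBlockGraph {n : ℕ} (G : QuantumGraph (ThreeBlocks n)) : Prop :=
  G.ψ.IsTracial ∧ ∀ x : ThreeBlocks n, G.A x = ![x 0 + x 1 + x 2, x 0 + x 1, 0]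

/-- The central projection `1_a` onto the `a`-th summand. -/
def blockProj {n : ℕ} (a : Fin 3) : ThreeBlocks n := Pi.single a 1

end QuantumGraph

end QuantumGraphs

end

open QuantumGraphs

/-!
Evaluating `m m* = δ²` on matrix units forces the weight of a trace on each block of a finite
dimensional C*-algebra to be `δ⁻²` times the size of that block, and normalization then determines
`δ`. This leaves a single tracial `δ`-form.

For the edge vector, `⟨ε | y · ε⟩ = δ⁻² A(y)`. If `A` is the adjacency operator of a digraph, the
path vector which follows an edge `a → b` and then stays on a loop at `b` therefore compresses `x`
to a multiple of its `a`-th component, placed in the block `b`. Choosing `a` with `‖xₐ‖ = ‖x‖`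
preserves the norm of `x`. The path starts in block `a` while all of its proper initial
segments end in block `b ≠ a`, so a return would factor through `1_b B 1_a = 0`.
-/

namespace QuantumGraphs

universe u

namespace Correspondence

variable {B : Type u} [CStarAlgebra B] [PartialOrder B] [StarOrderedRing B]

theorem inner_right_left_self (X : Correspondence B) (p q y : B) (ξ : X.carrier) :
    X.inner (X.right q (X.left p ξ)) (X.left y (X.right q (X.left p ξ)))
      = star q * X.inner ξ (X.left (star p * y * p) ξ) * q := by
  rw [X.left_right, X.inner_right, X.inner_right_left, X.inner_left, ← X.left_mul, ← X.left_mul]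

variable [FiniteDimensional ℂ B] {X : Correspondence B}

section PowTensor

variable {ξ η : X.carrier}

theorem inner_left_powTensor (ξ η : X.carrier) (k : ℕ) (b : B) :
    (X.tpow (k + 1)).inner (X.powTensor ξ η k) ((X.tpow (k + 1)).left b (X.powTensor ξ η k))
      = (fun c => X.inner η (X.left c η))^[k] (X.inner ξ (X.left b ξ)) := by
  induction k generalizing ξ b with
  | zero => rfl
  | succ k ih => exact ih η _

theorem left_powTensor {p : B} (hξ : X.left p ξ = ξ) (η : X.carrier) (k : ℕ) :
    (X.tpow (k + 1)).left p (X.powTensor ξ η k) = X.powTensor ξ η k := by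
  cases k with
  | zero => exact hξ
  | succ k => exact congrArg (tprod · (X.powTensor η η k)) hξ

theorem right_powTensor {q : B} (hξ : X.right q ξ = ξ) (hη : X.right q η = η) (k : ℕ) :
    (X.tpow (k + 1)).right q (X.powTensor ξ η k) = X.powTensor ξ η k := by
  induction k generalizing ξ with
  | zero => exact hξ
  | succ k ih => exact congrArg (tprod ξ) (ih hη)

end PowTensor

section NonReturning

variable {m : ℕ}

theorem star_univtPow_mul_univtPow (ξ η : (X.tpow m).carrier) :
    star (X.univtPow m ξ) * X.univtPow m η = X.univπ ((X.tpow m).inner ξ η) :=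
  (X.toeplitzPow ⟨univt X, (univ_isCovariant X).toIsToeplitz⟩ m).2.inner ξ η

theorem univπ_mul_univtPow (b : B) (ξ : (X.tpow m).carrier) :
    X.univπ b * X.univtPow m ξ = X.univtPow m ((X.tpow m).left b ξ) :=
  (X.toeplitzPow ⟨univt X, (univ_isCovariant X).toIsToeplitz⟩ m).2.left b ξ

theorem univtPow_powTensor_add (ξ η : X.carrier) (j k : ℕ) :
    X.univtPow (j + k + 2) (X.powTensor ξ η (j + k + 1))
      = X.univtPow (j + 1) (X.powTensor ξ η j) * X.univtPow (k + 1) (X.powTensor η η k) := by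
  induction j generalizing ξ with
  | zero =>
    rw [Nat.zero_add]
    rfl
  | succ j ih =>
    rw [Nat.add_right_comm j 1 k]
    calc X.univt ξ * X.univtPow (j + k + 2) (X.powTensor η η (j + k + 1))
        = X.univt ξ * X.univtPow (j + 1) (X.powTensor η η j)
          * X.univtPow (k + 1) (X.powTensor η η k) := by rw [ih, mul_assoc]

theorem isNonReturning_powTensor {ξ η : X.carrier} {p q : B} (hp : X.left p ξ = ξ)
    (hqξ : X.right q ξ = ξ) (hqη : X.right q η = η) (hqp : ∀ b, star q * b * p = 0) (k : ℕ) :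
    X.IsNonReturning (X.powTensor ξ η k) := by
  intro n hn hnk ζ
  obtain ⟨j, rfl⟩ : ∃ j, n = j + 1 := ⟨n - 1, by omega⟩
  obtain ⟨l, rfl⟩ : ∃ l, k = j + l + 1 := ⟨k - j - 1, by omega⟩
  have h_right := right_powTensor hqξ hqη j
  set initialPath := X.powTensor ξ η j
  set path := X.powTensor ξ η (j + l + 1)
  have h_inner : (X.tpow (j + 1)).inner initialPath ζ * p = 0 := by
    rw [← h_right, inner_right_left, hqp]
  have h_left : X.univπ p * X.univtPow (j + l + 2) path = X.univtPow (j + l + 2) path := by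
    rw [univπ_mul_univtPow, left_powTensor hp]
  calc star (X.univtPow (j + l + 2) path) * X.univtPow (j + 1) ζ * X.univtPow (j + l + 2) path
      = star (X.univtPow (l + 1) (X.powTensor η η l))
          * (star (X.univtPow (j + 1) initialPath) * X.univtPow (j + 1) ζ)
          * (X.univπ p * X.univtPow (j + l + 2) path) := by
        rw [h_left, ← mul_assoc (star _), ← star_mul, ← univtPow_powTensor_add]
    _ = star (X.univtPow (l + 1) (X.powTensor η η l))
          * X.univπ ((X.tpow (j + 1)).inner initialPath ζ * p)
          * X.univtPow (j + l + 2) path := by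
        rw [star_univtPow_mul_univtPow, map_mul]
        simp only [mul_assoc]
    _ = 0 := by rw [h_inner, map_zero, mul_zero, zero_mul]

theorem IsNonReturning.smul {ξ : (X.tpow m).carrier} (h : X.IsNonReturning ξ) (c : ℂ) :
    X.IsNonReturning (c • ξ) := fun n hn hnm ζ => by
  rw [map_smul, star_smul, smul_mul_assoc, smul_mul_assoc, mul_smul_comm, h n hn hnm ζ, smul_zero,
    smul_zero]

theorem conditionS_of_forall_exists_isNonReturning
    (h : ∀ x k, ∃ ξ : (X.tpow (k + 1)).carrier, (X.tpow (k + 1)).norm ξ = 1 ∧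
      X.IsNonReturning ξ ∧ ‖(X.tpow (k + 1)).inner ξ ((X.tpow (k + 1)).left x ξ)‖ = ‖x‖) :
    X.ConditionS := by
  intro x _ k ε hε
  obtain ⟨ξ, hξ, hξ', hx⟩ := h x k
  exact ⟨k + 1, k.lt_succ_self, ξ, hξ, hξ', by rw [hx]; exact lt_add_of_pos_right _ hε⟩

end NonReturning

end Correspondence

namespace FaithfulState

variable {B : Type u} [CStarAlgebra B] [PartialOrder B] [StarOrderedRing B]

theorem ext_apply {ψ φ : FaithfulState B} (h : ∀ x, ψ x = φ x) : ψ = φ := by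
  cases ψ
  cases φ
  congr
  exact DFunLike.ext _ _ h

/-- Dual bases `u`, `v` of `B` for the bilinear form `ψ(xy)`. They play the part of an orthonormal
basis `v` of `L²(B, ψ)` with `uᵢ = vᵢ*`, without singling out an involution. -/
def IsDualFrame {ι : Type*} [Fintype ι] (ψ : FaithfulState B) (u v : ι → B) : Prop :=
  ∀ x, ∑ i, ψ (x * u i) • v i = x

variable [FiniteDimensional ℂ B]

theorem exists_isDualFrame (ψ : FaithfulState B) :
    ∃ (d : ℕ) (u v : Fin d → B), ψ.IsDualFrame u v := by
  let f := stdOrthonormalBasis ℂ ψ.L2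
  refine ⟨_, fun i => ψ.toL2.symm (f i), fun i => star (ψ.toL2.symm (f i)), fun x => ?_⟩
  have h : ∑ i, ψ (star (ψ.toL2.symm (f i)) * star x) • ψ.toL2.symm (f i) = star x :=
    f.sum_repr' (ψ.toL2 (star x))
  have h_star := congrArg star h
  simpa only [star_sum, star_smul, ψ.star_apply_star_mul, star_star] using h_star

variable {ι : Type*} [Fintype ι] {ψ : FaithfulState B} {u v : ι → B}

theorem IsDualFrame.comul_eq_sum (h : ψ.IsDualFrame u v) (x : B) :
    ψ.comul x = ∑ i, (x * u i) ⊗ₜ v i := by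
  rw [comul, LinearMap.comp_apply, LinearMap.comp_apply, LinearEquiv.coe_coe,
    LinearEquiv.symm_apply_eq, TensorProduct.ext_iff_inner_left]
  intro y z
  obtain ⟨y, rfl⟩ := ψ.toL2.surjective y
  obtain ⟨z, rfl⟩ := ψ.toL2.surjective z
  calc inner ℂ (ψ.toL2 y ⊗ₜ ψ.toL2 z) (LinearMap.adjoint ψ.mulL2 (ψ.toL2 x))
      = ψ (star z * (star y * x)) := by
        rw [LinearMap.adjoint_inner_right, ← mul_assoc, ← star_mul]
        rfl
    _ = ∑ i, ψ (star y * (x * u i)) * ψ (star z * v i) := by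
        conv_lhs => rw [← h (star y * x), Finset.mul_sum, map_sum]
        simp only [mul_smul_comm, map_smul, smul_eq_mul, mul_assoc]
    _ = inner ℂ (ψ.toL2 y ⊗ₜ ψ.toL2 z)
          (TensorProduct.congr ψ.toL2 ψ.toL2 (∑ i, (x * u i) ⊗ₜ v i)) := by
        simp only [map_sum, TensorProduct.congr_tmul, inner_sum, TensorProduct.inner_tmul,
          inner_toL2]

theorem IsDualFrame.mul'_map_comul (h : ψ.IsDualFrame u v) (A₁ A₂ : B →ₗ[ℂ] B) (x : B) :
    LinearMap.mul' ℂ B (TensorProduct.map A₁ A₂ (ψ.comul x)) = ∑ i, A₁ (x * u i) * A₂ (v i) := by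
  simp only [h.comul_eq_sum, map_sum, TensorProduct.map_tmul, LinearMap.mul'_apply]

theorem IsDualFrame.mul'_comul (h : ψ.IsDualFrame u v) (x : B) :
    LinearMap.mul' ℂ B (ψ.comul x) = x * ∑ i, u i * v i := by
  simp only [h.comul_eq_sum, map_sum, LinearMap.mul'_apply, Finset.mul_sum, mul_assoc]

end FaithfulState

namespace QuantumGraph

variable {B : Type u} [CStarAlgebra B] [PartialOrder B] [StarOrderedRing B]
  [FiniteDimensional ℂ B] {G : QuantumGraph B}

theorem ofReal_δ_sq_ne_zero (G : QuantumGraph B) : (G.δ : ℂ) ^ 2 ≠ 0 :=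
  pow_ne_zero 2 (Complex.ofReal_ne_zero.mpr G.isDeltaForm.1.ne')

theorem edgeElement_eq_sum {ι : Type*} [Fintype ι] {u v : ι → B} (h : G.ψ.IsDualFrame u v) :
    G.edgeElement = (((G.δ : ℂ) ^ 2)⁻¹ • ∑ i, u i ⊗ₜ G.A (v i) : B ⊗[ℂ] B) := by
  rw [edgeElement, h.comul_eq_sum, map_sum]
  simp only [one_mul, LinearMap.lTensor_tmul]
  rfl

theorem inner_edgeVector (G : QuantumGraph B) (y : B) :
    G.edgeCorrespondence.inner G.edgeVector (G.edgeCorrespondence.left y G.edgeVector)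
      = ((G.δ : ℂ) ^ 2)⁻¹ • G.A y := by
  obtain ⟨d, u, v, h⟩ := G.ψ.exists_isDualFrame
  have h_expand : ∀ j, ∑ i, G.ψ (star (u i) * (y * u j)) • (star (G.A (v i)) * G.A (v j))
      = G.A (y * u j) * G.A (v j) := fun j => by
    conv_rhs => rw [← star_star (y * u j), ← h (star (y * u j))]
    simp only [star_sum, star_smul, map_sum, map_smul, map_star, Finset.sum_mul, smul_mul_assoc,
      FaithfulState.star_apply_star_mul]
  have h_schur : ∑ j, G.A (y * u j) * G.A (v j) = (G.δ : ℂ) ^ 2 • G.A y :=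
    (h.mul'_map_comul G.A.toLinearMap G.A.toLinearMap y).symm.trans (LinearMap.congr_fun G.schur y)
  change G.ψ.tensorInner G.edgeElement ((LinearMap.mul ℂ B y).rTensor B G.edgeElement) = _
  rw [edgeElement_eq_sum h]
  calc _ = ((G.δ : ℂ) ^ 2)⁻¹ • ((G.δ : ℂ) ^ 2)⁻¹ • ∑ j, ∑ i, G.ψ (star (u i) * (y * u j)) •
          (star (G.A (v i)) * G.A (v j)) := by
        simp only [map_smul, map_sum, LinearMap.rTensor_tmul, LinearMap.map_smulₛₗ,
          LinearMap.smul_apply, LinearMap.sum_apply, FaithfulState.tensorInner_tmul,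
          LinearMap.mul_apply_apply, map_inv₀, map_pow, Complex.conj_ofReal, ← Finset.smul_sum]
    _ = ((G.δ : ℂ) ^ 2)⁻¹ • G.A y := by
        simp only [h_expand]
        rw [h_schur, inv_smul_smul₀ G.ofReal_δ_sq_ne_zero]

theorem inner_left_pathVector (G : QuantumGraph B) (p q x : B) (k : ℕ) :
    (G.edgeCorrespondence.tpow (k + 1)).inner (G.pathVector p q k)
        ((G.edgeCorrespondence.tpow (k + 1)).left x (G.pathVector p q k))
      = (fun y => ((G.δ : ℂ) ^ 2)⁻¹ • (star q * G.A y * q))^[k + 1] (star p * x * p) := by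
  have h_edge : ∀ y, star q *
      G.edgeCorrespondence.inner G.edgeVector (G.edgeCorrespondence.left y G.edgeVector) * q
      = ((G.δ : ℂ) ^ 2)⁻¹ • (star q * G.A y * q) := fun y => by
    rw [inner_edgeVector, mul_smul_comm, smul_mul_assoc]
  rw [pathVector, Correspondence.inner_left_powTensor, Correspondence.inner_right_left_self,
    h_edge, Function.iterate_succ_apply]
  congr 2
  funext y
  rw [Correspondence.left_right, Correspondence.inner_right, Correspondence.inner_right_left,
    h_edge]

theorem isNonReturning_pathVector (G : QuantumGraph B) {p q : B} (hp : IsIdempotentElem p)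
    (hq : IsIdempotentElem q) (hqp : ∀ b, star q * b * p = 0) (k : ℕ) :
    G.edgeCorrespondence.IsNonReturning (G.pathVector p q k) := by
  have h_right : ∀ ξ, G.edgeCorrespondence.right q (G.edgeCorrespondence.right q ξ)
      = G.edgeCorrespondence.right q ξ := fun ξ => by
    rw [← Correspondence.right_mul, hq.eq]
  refine Correspondence.isNonReturning_powTensor ?_ (h_right _) (h_right _) hqp k
  rw [Correspondence.left_right, ← Correspondence.left_mul, hp.eq]

theorem left_pathVector (G : QuantumGraph B) {p : B} (hp : IsIdempotentElem p) (q : B) (k : ℕ) :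
    (G.edgeCorrespondence.tpow (k + 1)).left p (G.pathVector p q k) = G.pathVector p q k :=
  Correspondence.left_powTensor
    (by rw [Correspondence.left_right, ← Correspondence.left_mul, hp.eq]) _ k

end QuantumGraph

section Trace

theorem map_eq_trace_smul_of_map_mul_comm {R n M : Type*} [CommSemiring R] [Fintype n]
    [DecidableEq n] [AddCommMonoid M] [Module R M] (φ : Matrix n n R →ₗ[R] M)
    (hφ : ∀ x y, φ (x * y) = φ (y * x)) (o : n) (x : Matrix n n R) :
    φ x = x.trace • φ (Matrix.single o o 1) := by
  suffices φ = (Matrix.traceLinearMap n R R).smulRight (φ (Matrix.single o o 1)) from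
    LinearMap.congr_fun this x
  refine Matrix.ext_linearMap _ fun i j => LinearMap.ext_ring ?_
  calc φ (Matrix.single i j 1)
      = φ (Matrix.single o j 1 * Matrix.single i o 1) := by
        rw [hφ, Matrix.single_mul_single_same, mul_one]
    _ = (Matrix.single i j (1 : R)).trace • φ (Matrix.single o o 1) := by
        obtain rfl | hij := eq_or_ne i j
        · rw [Matrix.single_mul_single_same, mul_one, Matrix.trace_single_eq_same, one_smul]
        · rw [Matrix.single_mul_single_of_ne (h := hij.symm), map_zero,
            Matrix.trace_single_eq_of_ne _ _ _ hij, zero_smul]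

variable {ι : Type*} {κ : ι → Type*} [∀ a, Fintype (κ a)] [∀ a, DecidableEq (κ a)]

section BlockUnit

variable [DecidableEq ι] (a : ι)

/-- The matrix unit `e_{ij}` of the `a`-th summand of `⨁ₐ M_{κ a}(ℂ)`. -/
def blockUnit (i j : κ a) : ∀ a, Matrix (κ a) (κ a) ℂ :=
  Pi.single a (Matrix.single i j 1)

theorem blockUnit_mul_blockUnit (i j k : κ a) :
    blockUnit a i j * blockUnit a j k = blockUnit a i k := by
  rw [blockUnit, blockUnit, ← Pi.single_mul, Matrix.single_mul_single_same, mul_one, blockUnit]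

theorem sum_smul_blockUnit (x : Matrix (κ a) (κ a) ℂ) :
    ∑ i, ∑ j, x i j • blockUnit a i j = Pi.single a x := by
  conv_rhs => rw [Matrix.matrix_eq_sum_single x]
  simp only [blockUnit, ← LinearMap.coe_single ℂ, map_sum, ← map_smul, Matrix.smul_single,
    smul_eq_mul, mul_one]

theorem sum_blockUnit_self : ∑ i : κ a, blockUnit a i i = Pi.single a 1 := by
  simp only [blockUnit, ← LinearMap.coe_single ℂ, ← map_sum, Matrix.sum_single_one]

end BlockUnit

namespace FaithfulState

variable [Fintype ι]

/-- `ψ` is the combination `∑ₐ cₐ Tr` of the traces of the matrix blocks. -/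
def HasTraceWeights (ψ : FaithfulState (∀ a, Matrix (κ a) (κ a) ℂ)) (c : ι → ℂ) : Prop :=
  ∀ x, ψ x = ∑ a, c a * (x a).trace

variable {ψ φ : FaithfulState (∀ a, Matrix (κ a) (κ a) ℂ)} {c : ι → ℂ} {δ : ℝ}

theorem IsTracial.exists_hasTraceWeights [∀ a, Nonempty (κ a)] (hψ : ψ.IsTracial) :
    ∃ c, ψ.HasTraceWeights c := by
  classical
  let o (a : ι) : κ a := Classical.arbitrary _
  refine ⟨fun a => ψ (blockUnit a (o a) (o a)), fun x => ?_⟩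
  let φ (a : ι) : Matrix (κ a) (κ a) ℂ →ₗ[ℂ] ℂ :=
    ψ.toPositive.toLinearMap ∘ₗ LinearMap.single ℂ (fun a => Matrix (κ a) (κ a) ℂ) a
  have hφ (a : ι) (y z : Matrix (κ a) (κ a) ℂ) : φ a (y * z) = φ a (z * y) := by
    change ψ (Pi.single a (y * z)) = ψ (Pi.single a (z * y))
    rw [Pi.single_mul, hψ, ← Pi.single_mul]
  calc ψ x = ∑ a, φ a (x a) := by
        conv_lhs => rw [← Finset.univ_sum_single x, map_sum]
        rfl
    _ = ∑ a, ψ (blockUnit a (o a) (o a)) * (x a).trace :=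
        Finset.sum_congr rfl fun a _ =>
          (map_eq_trace_smul_of_map_mul_comm (φ a) (hφ a) (o a) (x a)).trans (mul_comm _ _)

namespace HasTraceWeights

theorem isTracial (h : ψ.HasTraceWeights c) : ψ.IsTracial := fun x y => by
  rw [h, h]
  exact Finset.sum_congr rfl fun a _ => congrArg (c a * ·) (Matrix.trace_mul_comm (x a) (y a))

theorem unique (hψ : ψ.HasTraceWeights c) (hφ : φ.HasTraceWeights c) : ψ = φ :=
  ext_apply fun x => (hψ x).trans (hφ x).symm

theorem sum_weight_mul_card (h : ψ.HasTraceWeights c) :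
    ∑ a, c a * Fintype.card (κ a) = 1 := by
  simpa only [Pi.one_apply, Matrix.trace_one] using (h 1).symm.trans ψ.map_one

theorem apply_mul_blockUnit [DecidableEq ι] (h : ψ.HasTraceWeights c)
    (x : ∀ a, Matrix (κ a) (κ a) ℂ) (a : ι) (i j : κ a) :
    ψ (x * blockUnit a i j) = c a * x a j i := by
  rw [h, blockUnit, ← Pi.single_mul_right, Finset.sum_eq_single a]
  · rw [Pi.single_eq_same, Matrix.trace_mul_single, MulOpposite.op_one, one_smul]
  · intro b _ hb
    rw [Pi.single_eq_of_ne hb, Matrix.trace_zero, mul_zero]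
  · exact fun ha => absurd (Finset.mem_univ a) ha

theorem isDualFrame [DecidableEq ι] (h : ψ.HasTraceWeights c) (hc : ∀ a, c a ≠ 0) :
    ψ.IsDualFrame (fun s : Σ a, κ a × κ a => blockUnit s.1 s.2.1 s.2.2)
      (fun s => (c s.1)⁻¹ • blockUnit s.1 s.2.2 s.2.1) := fun x => by
  have h_coeff (a : ι) (i j : κ a) : ψ (x * blockUnit a i j) * (c a)⁻¹ = x a j i := by
    rw [h.apply_mul_blockUnit, mul_comm, inv_mul_cancel_left₀ (hc a)]
  have h_block (a : ι) : ∑ i, ∑ j, x a j i • blockUnit a j i = Pi.single a (x a) := by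
    rw [Finset.sum_comm, sum_smul_blockUnit]
  simp only [smul_smul, h_coeff, Fintype.sum_sigma, Fintype.sum_prod_type, h_block,
    Finset.univ_sum_single]

variable [∀ a, Nonempty (κ a)]

theorem weight_ne_zero (h : ψ.HasTraceWeights c) (a : ι) : c a ≠ 0 := by
  classical
  obtain ⟨i⟩ := (inferInstance : Nonempty (κ a))
  intro hc
  have h_unit : blockUnit a i i = 0 := ψ.faithful _ (by rw [h.apply_mul_blockUnit, hc, zero_mul])
  rw [blockUnit, Pi.single_eq_zero_iff] at h_unit
  simpa using congrFun₂ h_unit i i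

theorem mul'_comul (h : ψ.HasTraceWeights c) (x : ∀ a, Matrix (κ a) (κ a) ℂ) :
    LinearMap.mul' ℂ _ (ψ.comul x) = fun a => (Fintype.card (κ a) / c a) • x a := by
  classical
  have h_block (a : ι) : ∑ i : κ a, ∑ j : κ a, blockUnit a i j * (c a)⁻¹ • blockUnit a j i
      = Pi.single a ((Fintype.card (κ a) / c a) • 1) := by
    simp only [mul_smul_comm, blockUnit_mul_blockUnit, Finset.sum_const, Finset.card_univ,
      ← Finset.smul_sum, sum_blockUnit_self]
    rw [div_eq_mul_inv, mul_smul, ← Nat.cast_smul_eq_nsmul ℂ, Pi.single_smul, Pi.single_smul]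
  have h_frame := (h.isDualFrame h.weight_ne_zero).mul'_comul x
  simp only [Fintype.sum_sigma, Fintype.sum_prod_type, h_block, Finset.univ_sum_single] at h_frame
  rw [h_frame]
  funext a
  rw [Pi.mul_apply, mul_smul_comm, mul_one]

theorem isDeltaForm_iff (h : ψ.HasTraceWeights c) :
    ψ.IsDeltaForm δ ↔ 0 < δ ∧ ∀ a, (Fintype.card (κ a) : ℂ) = δ ^ 2 * c a := by
  refine and_congr_right fun _ => ⟨fun h_comul a => ?_, fun h_card => ?_⟩
  · obtain ⟨i⟩ := (inferInstance : Nonempty (κ a))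
    have h_one := (h.mul'_comul 1).symm.trans (LinearMap.congr_fun h_comul 1)
    have h_entry : (Fintype.card (κ a) / c a : ℂ) = δ ^ 2 := by
      simpa using congrFun₂ (congrFun h_one a) i i
    rw [← h_entry, div_mul_cancel₀ _ (h.weight_ne_zero a)]
  · refine LinearMap.ext fun x => (h.mul'_comul x).trans (funext fun a => ?_)
    rw [h_card, mul_div_cancel_right₀ _ (h.weight_ne_zero a)]
    rfl

end HasTraceWeights

theorem IsDeltaForm.sq_eq [∀ a, Nonempty (κ a)] (hδ : ψ.IsDeltaForm δ)
    (h : ψ.HasTraceWeights c) : (δ : ℂ) ^ 2 = ∑ a, (Fintype.card (κ a) : ℂ) ^ 2 := by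
  have h_card := (h.isDeltaForm_iff.mp hδ).2
  calc (δ : ℂ) ^ 2 = ∑ a, δ ^ 2 * c a * Fintype.card (κ a) := by
        simp only [mul_assoc, ← Finset.mul_sum, h.sum_weight_mul_card, mul_one]
    _ = ∑ a, (Fintype.card (κ a) : ℂ) ^ 2 :=
        Finset.sum_congr rfl fun a _ => by rw [← h_card, sq]

/-- The faithful state `∑ₐ cₐ Tr`. -/
noncomputable def ofTraceWeights (c : ι → ℂ) (hc : ∀ a, 0 < c a)
    (hsum : ∑ a, c a * Fintype.card (κ a) = 1) :
    FaithfulState (∀ a, Matrix (κ a) (κ a) ℂ) where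
  toPositive := PositiveLinearMap.mk₀
    { toFun x := ∑ a, c a * (x a).trace
      map_add' x y := by simp [mul_add, Finset.sum_add_distrib]
      map_smul' r x := by simp [Finset.mul_sum, mul_left_comm] }
    fun x hx => Finset.sum_nonneg fun a _ => mul_nonneg (hc a).le
      (Matrix.nonneg_iff_posSemidef.mp (hx a)).trace_nonneg
  map_one := by
    simp only [← Matrix.trace_one] at hsum
    exact hsum
  faithful x hx := by
    have h_nonneg (a : ι) : 0 ≤ c a * (star (x a) * x a).trace := mul_nonneg (hc a).le
      (Matrix.nonneg_iff_posSemidef.mp (star_mul_self_nonneg (x a))).trace_nonneg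
    have h_zero := (Finset.sum_eq_zero_iff_of_nonneg fun a _ => h_nonneg a).mp hx
    funext a
    exact Matrix.trace_conjTranspose_mul_self_eq_zero_iff.mp
      ((mul_eq_zero_iff_left (hc a).ne').mp (h_zero a (Finset.mem_univ a)))

theorem hasTraceWeights_ofTraceWeights (hc : ∀ a, 0 < c a)
    (hsum : ∑ a, c a * Fintype.card (κ a) = 1) : (ofTraceWeights c hc hsum).HasTraceWeights c :=
  fun _ => rfl

variable (κ) in
/-- The weights `n_a / ∑_b n_b²` of the normalized Plancherel trace, where `n_a = card (κ a)`. -/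
noncomputable def plancherelWeight (a : ι) : ℂ :=
  Fintype.card (κ a) / ∑ b, (Fintype.card (κ b) : ℂ) ^ 2

variable [∀ a, Nonempty (κ a)]

theorem IsTracial.hasTraceWeights_plancherelWeight (hψ : ψ.IsTracial) (hδ : ψ.IsDeltaForm δ) :
    ψ.HasTraceWeights (plancherelWeight κ) := by
  obtain ⟨c, h⟩ := hψ.exists_hasTraceWeights
  obtain ⟨hδ_pos, h_card⟩ := h.isDeltaForm_iff.mp hδ
  have hδ_ne : (δ : ℂ) ^ 2 ≠ 0 := pow_ne_zero 2 (Complex.ofReal_ne_zero.mpr hδ_pos.ne')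
  have h_weight : plancherelWeight κ = c := funext fun a => by
    simp only [plancherelWeight]
    rw [← hδ.sq_eq h, h_card, mul_div_cancel_left₀ _ hδ_ne]
  rwa [h_weight]

variable (κ) in
theorem exists_hasTraceWeights_plancherelWeight [Nonempty ι] :
    ∃ ψ : FaithfulState (∀ a, Matrix (κ a) (κ a) ℂ), ψ.HasTraceWeights (plancherelWeight κ) ∧
      ∃ δ : ℝ, ψ.IsDeltaForm δ := by
  have h_card_pos (a : ι) : 0 < Fintype.card (κ a) := Fintype.card_pos
  have h_dim_pos : 0 < ∑ b, Fintype.card (κ b) ^ 2 :=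
    Finset.sum_pos (fun a _ => pow_pos (h_card_pos a) 2) Finset.univ_nonempty
  have h_dim_pos' : (0 : ℂ) < ∑ b, (Fintype.card (κ b) : ℂ) ^ 2 := mod_cast h_dim_pos
  have h_weight_pos (a : ι) : 0 < plancherelWeight κ a :=
    div_pos (Nat.cast_pos.mpr (h_card_pos a)) h_dim_pos'
  have h_sum : ∑ a, plancherelWeight κ a * Fintype.card (κ a) = 1 := by
    simp only [plancherelWeight, div_mul_eq_mul_div, ← sq, ← Finset.sum_div]
    exact div_self h_dim_pos'.ne'
  refine ⟨_, hasTraceWeights_ofTraceWeights h_weight_pos h_sum,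
    √(∑ b, Fintype.card (κ b) ^ 2 : ℕ), ?_⟩
  rw [(hasTraceWeights_ofTraceWeights h_weight_pos h_sum).isDeltaForm_iff]
  refine ⟨Real.sqrt_pos.mpr (Nat.cast_pos.mpr h_dim_pos), fun a => ?_⟩
  rw [← Complex.ofReal_pow, Real.sq_sqrt (Nat.cast_nonneg _)]
  push_cast
  exact (mul_div_cancel₀ _ h_dim_pos'.ne').symm

variable (κ) in
theorem existsUnique_isTracial_isDeltaForm [Nonempty ι] :
    ∃! ψ : FaithfulState (∀ a, Matrix (κ a) (κ a) ℂ),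
      ψ.IsTracial ∧ ∃ δ : ℝ, ψ.IsDeltaForm δ := by
  obtain ⟨ψ, hψ, hδ⟩ := exists_hasTraceWeights_plancherelWeight κ
  exact ⟨ψ, ⟨hψ.isTracial, hδ⟩, fun φ ⟨hφ, _, hφδ⟩ =>
    (hφ.hasTraceWeights_plancherelWeight hφδ).unique hψ⟩

end FaithfulState

end Trace

section Digraph

open scoped CStarAlgebra

section CompletelyPositive

variable {A₁ A₂ : Type*} [NonUnitalCStarAlgebra A₁] [PartialOrder A₁] [StarOrderedRing A₁]
  [NonUnitalCStarAlgebra A₂] [PartialOrder A₂] [StarOrderedRing A₂] {ι : Type*} [Fintype ι]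

/-- The sum of a finite family of completely positive maps. -/
noncomputable def completelyPositiveSum (φ : ι → A₁ →CP A₂) : A₁ →CP A₂ where
  toLinearMap := ∑ i, (φ i).toLinearMap
  map_cstarMatrix_nonneg' k M hM := by
    have h_sum : M.map ⇑(∑ i, (φ i).toLinearMap) = ∑ i, M.map (φ i) :=
      CStarMatrix.ext fun r s =>
        (LinearMap.sum_apply _ _ _).trans
          (Matrix.sum_apply r s Finset.univ fun i => M.map (φ i)).symm
    rw [h_sum]
    exact Finset.sum_nonneg fun i _ => (φ i).map_cstarMatrix_nonneg' k M hM

theorem completelyPositiveSum_apply (φ : ι → A₁ →CP A₂) (x : A₁) :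
    completelyPositiveSum φ x = ∑ i, φ i x :=
  LinearMap.sum_apply _ _ _

end CompletelyPositive

variable {ι M : Type*} [NonUnitalCStarAlgebra M] (D : Digraph ι) [DecidableRel D.Adj]

/-- Copies the `a`-th summand of `⨁ M` into each summand `b` for which `a → b` is an edge. -/
def outEdgesHom (a : ι) : (ι → M) →⋆ₙₐ[ℂ] (ι → M) where
  toFun x b := if D.Adj a b then x a else 0
  map_smul' c x := funext fun b => (smul_ite_zero (D.Adj a b) c (x a)).symm
  map_zero' := funext fun b => ite_self _
  map_add' x y := funext fun b => ite_add_zero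
  map_mul' x y := funext fun b => by
    simp only [Pi.mul_apply, ite_zero_mul_ite_zero, and_self]
  map_star' x := funext fun b => by simp only [Pi.star_apply, apply_ite star, star_zero]

variable [Fintype ι]
  [PartialOrder M] [StarOrderedRing M]

variable (M) in
/-- The adjacency operator `x ↦ (∑_{a → b} xₐ)_b` of a digraph, with coefficients in `M`. -/
noncomputable def digraphMap : (ι → M) →CP (ι → M) :=
  completelyPositiveSum fun a =>
    CompletelyPositiveMapClass.toCompletelyPositiveLinearMap (outEdgesHom D a)

theorem digraphMap_apply (x : ι → M) (b : ι) :
    digraphMap M D x b = ∑ a, if D.Adj a b then x a else 0 := by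
  rw [digraphMap, completelyPositiveSum_apply, Finset.sum_apply]
  rfl

theorem digraphMap_single [DecidableEq ι] (a b : ι) (m : M) :
    digraphMap M D (Pi.single a m) b = if D.Adj a b then m else 0 := by
  rw [digraphMap_apply, Finset.sum_eq_single a]
  · rw [Pi.single_eq_same]
  · intro c _ hca
    rw [Pi.single_eq_of_ne hca, ite_self]
  · exact fun ha => absurd (Finset.mem_univ a) ha

theorem digraphMap_single_mul_digraphMap_single [DecidableEq ι] (a : ι) (m₁ m₂ : M) :
    digraphMap M D (Pi.single a m₁) * digraphMap M D (Pi.single a m₂)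
      = digraphMap M D (Pi.single a (m₁ * m₂)) := by
  funext b
  simp only [Pi.mul_apply, digraphMap_single, ite_zero_mul_ite_zero, and_self]

theorem FaithfulState.HasTraceWeights.mul'_map_digraphMap_comul {κ : Type*} [Fintype κ]
    [DecidableEq κ] [Nonempty κ] {ψ : FaithfulState (ι → Matrix κ κ ℂ)} {c : ι → ℂ}
    (h : HasTraceWeights (κ := fun _ => κ) ψ c) (x : ι → Matrix κ κ ℂ) :
    LinearMap.mul' ℂ _ (TensorProduct.map (digraphMap (Matrix κ κ ℂ) D).toLinearMap
        (digraphMap (Matrix κ κ ℂ) D).toLinearMap (ψ.comul x))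
      = digraphMap (Matrix κ κ ℂ) D (LinearMap.mul' ℂ _ (ψ.comul x)) := by
  classical
  set A := digraphMap (Matrix κ κ ℂ) D
  have h_mul (a : ι) (m₁ m₂ : Matrix κ κ ℂ) :
      A (x * Pi.single a m₁) * A (Pi.single a m₂) = A (x * (Pi.single a m₁ * Pi.single a m₂)) := by
    rw [← mul_assoc, ← Pi.single_mul_right, digraphMap_single_mul_digraphMap_single, Pi.single_mul]
  have h_frame := h.isDualFrame h.weight_ne_zero
  rw [h_frame.mul'_map_comul, h_frame.mul'_comul, Finset.mul_sum, map_sum]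
  refine Finset.sum_congr rfl fun ⟨a, i, j⟩ _ => ?_
  simp only [blockUnit, ← Pi.single_smul]
  exact h_mul a _ _

theorem exists_isTracial_and_A_eq_digraphMap [Nonempty ι] (κ : Type*) [Fintype κ]
    [DecidableEq κ] [Nonempty κ] :
    ∃ G : QuantumGraph (ι → Matrix κ κ ℂ), G.ψ.IsTracial ∧ G.A = digraphMap (Matrix κ κ ℂ) D := by
  obtain ⟨ψ, h, δ, hδ⟩ := FaithfulState.exists_hasTraceWeights_plancherelWeight fun _ : ι => κ
  refine ⟨⟨ψ, δ, hδ, digraphMap _ D, LinearMap.ext fun x => ?_⟩, h.isTracial, rfl⟩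
  calc _ = digraphMap (Matrix κ κ ℂ) D (LinearMap.mul' ℂ _ (ψ.comul x)) :=
        h.mul'_map_digraphMap_comul D x
    _ = (δ : ℂ) ^ 2 • digraphMap (Matrix κ κ ℂ) D x :=
        (congrArg _ (LinearMap.congr_fun hδ.2 x)).trans
          (map_smul (digraphMap (Matrix κ κ ℂ) D) _ x)

namespace QuantumGraph

variable {M : Type*} [CStarAlgebra M] [PartialOrder M] [StarOrderedRing M] [FiniteDimensional ℂ M]
  {D} {G : QuantumGraph (ι → M)}

section Paths

variable [DecidableEq ι] {a b : ι}

theorem inner_left_pathVector_single (hA : G.A = digraphMap M D) (hab : D.Adj a b)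
    (hbb : D.Adj b b) (x : ι → M) (k : ℕ) :
    (G.edgeCorrespondence.tpow (k + 1)).inner (G.pathVector (Pi.single a 1) (Pi.single b 1) k)
        ((G.edgeCorrespondence.tpow (k + 1)).left x
          (G.pathVector (Pi.single a 1) (Pi.single b 1) k))
      = (((G.δ : ℂ) ^ 2)⁻¹) ^ (k + 1) • Pi.single b (x a) := by
  have h_compress (c : ι) (y : ι → M) :
      star (Pi.single c 1) * y * Pi.single c 1 = Pi.single c (y c) := by
    rw [← Pi.single_star, star_one, ← Pi.single_mul_left, ← Pi.single_mul, one_mul, mul_one]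
  have h_step (c : ι) (hcb : D.Adj c b) (m : M) :
      ((G.δ : ℂ) ^ 2)⁻¹ • (star (Pi.single b 1) * G.A (Pi.single c m) * Pi.single b 1)
        = Pi.single b (((G.δ : ℂ) ^ 2)⁻¹ • m) := by
    rw [h_compress, hA, digraphMap_single, if_pos hcb, Pi.single_smul]
  rw [inner_left_pathVector, h_compress, ← Pi.single_smul]
  induction k with
  | zero => rw [Function.iterate_one, h_step a hab, zero_add, pow_one]
  | succ k ih => rw [Function.iterate_succ_apply', ih, h_step b hbb, smul_smul, ← pow_succ']

theorem exists_smul_pathVector_single [Nontrivial M] (hA : G.A = digraphMap M D)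
    (hab : D.Adj a b) (hbb : D.Adj b b) (k : ℕ) :
    ∃ ξ : (G.edgeCorrespondence.tpow (k + 1)).carrier,
      (∃ c : ℝ, 0 < c ∧ ξ = (c : ℂ) • G.pathVector (Pi.single a 1) (Pi.single b 1) k) ∧
      (G.edgeCorrespondence.tpow (k + 1)).norm ξ = 1 ∧
      ∀ y, (G.edgeCorrespondence.tpow (k + 1)).inner ξ
        ((G.edgeCorrespondence.tpow (k + 1)).left y ξ) = Pi.single b (y a) := by
  set ξ := ((G.δ ^ (k + 1) : ℝ) : ℂ) • G.pathVector (Pi.single a 1) (Pi.single b 1) k with hξ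
  have h_inner (y : ι → M) : (G.edgeCorrespondence.tpow (k + 1)).inner ξ
      ((G.edgeCorrespondence.tpow (k + 1)).left y ξ) = Pi.single b (y a) := by
    have h_scale : (G.δ : ℂ) ^ (k + 1) * G.δ ^ (k + 1) * (((G.δ : ℂ) ^ 2)⁻¹) ^ (k + 1) = 1 := by
      rw [← mul_pow, ← mul_pow, ← sq, mul_inv_cancel₀ G.ofReal_δ_sq_ne_zero, one_pow]
    simp only [hξ, LinearMap.map_smulₛₗ, LinearMap.smul_apply, RingHom.id_apply,
      Complex.conj_ofReal]
    rw [inner_left_pathVector_single hA hab hbb, smul_smul, smul_smul, Complex.ofReal_pow,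
      h_scale, one_smul]
  have h_left : (G.edgeCorrespondence.tpow (k + 1)).left (Pi.single a 1) ξ = ξ := by
    rw [hξ, map_smul, left_pathVector G ((CompleteOrthogonalIdempotents.single fun _ => M).idem a)]
  have h_norm := h_inner (Pi.single a 1)
  rw [h_left, Pi.single_eq_same] at h_norm
  refine ⟨ξ, ⟨_, pow_pos G.isDeltaForm.1 _, rfl⟩, ?_, h_inner⟩
  rw [Correspondence.norm, h_norm, Pi.norm_single, norm_one, Real.sqrt_one]

theorem isNonReturning_pathVector_single (G : QuantumGraph (ι → M)) (hab : a ≠ b) (k : ℕ) :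
    G.edgeCorrespondence.IsNonReturning (G.pathVector (Pi.single a 1) (Pi.single b 1) k) := by
  have h_idem := (CompleteOrthogonalIdempotents.single fun _ : ι => M).idem
  refine isNonReturning_pathVector G (h_idem a) (h_idem b) (fun y => ?_) k
  rw [← Pi.single_star, ← Pi.single_mul_left, ← Pi.single_mul_right, Pi.single_eq_of_ne hab,
    zero_mul, Pi.single_zero]

theorem exists_isNonReturning_smul_pathVector [Nontrivial M] [Nonempty ι]
    (hA : G.A = digraphMap M D) (hD : ∀ a, ∃ b, a ≠ b ∧ D.Adj a b ∧ D.Adj b b) (x : ι → M) :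
    ∃ a b : ι, a ≠ b ∧ ∀ k : ℕ, ∃ ξ : (G.edgeCorrespondence.tpow (k + 1)).carrier,
      (∃ c : ℝ, 0 < c ∧ ξ = (c : ℂ) • G.pathVector (Pi.single a 1) (Pi.single b 1) k) ∧
      (G.edgeCorrespondence.tpow (k + 1)).norm ξ = 1 ∧
      G.edgeCorrespondence.IsNonReturning ξ ∧
      ‖(G.edgeCorrespondence.tpow (k + 1)).inner ξ
        ((G.edgeCorrespondence.tpow (k + 1)).left x ξ)‖ = ‖x‖ := by
  obtain ⟨a, h_max⟩ := Finite.exists_max fun a => ‖x a‖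
  have h_norm : ‖x a‖ = ‖x‖ :=
    le_antisymm (norm_le_pi_norm x a) ((pi_norm_le_iff_of_nonneg (norm_nonneg _)).mpr h_max)
  obtain ⟨b, hab, hab_adj, hbb⟩ := hD a
  refine ⟨a, b, hab, fun k => ?_⟩
  obtain ⟨ξ, ⟨c, hc, rfl⟩, h_unit, h_inner⟩ := exists_smul_pathVector_single hA hab_adj hbb k
  refine ⟨_, ⟨c, hc, rfl⟩, h_unit, (isNonReturning_pathVector_single G hab k).smul c, ?_⟩
  rw [h_inner, Pi.norm_single, h_norm]

end Paths

theorem conditionS_of_A_eq_digraphMap [Nontrivial M] [Nonempty ι] (hA : G.A = digraphMap M D)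
    (hD : ∀ a, ∃ b, a ≠ b ∧ D.Adj a b ∧ D.Adj b b) : G.edgeCorrespondence.ConditionS := by
  classical
  refine Correspondence.conditionS_of_forall_exists_isNonReturning fun x k => ?_
  obtain ⟨a, b, -, h⟩ := exists_isNonReturning_smul_pathVector hA hD x
  obtain ⟨ξ, -, hξ⟩ := h k
  exact ⟨ξ, hξ⟩

end QuantumGraph

end Digraph

/-- The digraph underlying the adjacency operator `x ↦ (x₁ + x₂ + x₃) ⊕ (x₁ + x₂) ⊕ 0`, with the
three summands numbered from `0`. -/
def threeBlockDigraph : Digraph (Fin 3) where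
  Adj a b := b = 0 ∨ b = 1 ∧ a ≠ 2

instance : DecidableRel threeBlockDigraph.Adj :=
  fun a b => inferInstanceAs (Decidable (b = 0 ∨ b = 1 ∧ a ≠ 2))

theorem digraphMap_threeBlockDigraph_apply {M : Type*} [NonUnitalCStarAlgebra M] [PartialOrder M]
    [StarOrderedRing M] (x : Fin 3 → M) :
    digraphMap M threeBlockDigraph x = ![x 0 + x 1 + x 2, x 0 + x 1, 0] := by
  funext b
  rw [digraphMap_apply, Fin.sum_univ_three]
  fin_cases b <;> simp [threeBlockDigraph]

theorem QuantumGraph.isThreeBlockGraph_iff {n : ℕ} {G : QuantumGraph (ThreeBlocks n)} :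
    IsThreeBlockGraph G ↔
      G.ψ.IsTracial ∧ G.A = digraphMap (Matrix (Fin n) (Fin n) ℂ) threeBlockDigraph := by
  simp only [IsThreeBlockGraph, DFunLike.ext_iff, digraphMap_threeBlockDigraph_apply]

theorem threeBlockDigraph_exists_loop_edge (a : Fin 3) :
    ∃ b, a ≠ b ∧ threeBlockDigraph.Adj a b ∧ threeBlockDigraph.Adj b b := by
  decide +revert

end QuantumGraphs

theorem mainTheorem6_general {ι κ : Type*} [Fintype ι] [DecidableEq ι] [Nonempty ι] [Fintype κ]
    [DecidableEq κ] [Nonempty κ] (D : Digraph ι) [DecidableRel D.Adj]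
    (hD : ∀ a, ∃ b, a ≠ b ∧ D.Adj a b ∧ D.Adj b b) :
    (∃! ψ : FaithfulState (ι → Matrix κ κ ℂ), ψ.IsTracial ∧ ∃ δ : ℝ, ψ.IsDeltaForm δ) ∧
    (∃ G : QuantumGraph (ι → Matrix κ κ ℂ),
      G.ψ.IsTracial ∧ G.A = digraphMap (Matrix κ κ ℂ) D) ∧
    ∀ G : QuantumGraph (ι → Matrix κ κ ℂ), G.A = digraphMap (Matrix κ κ ℂ) D →
      G.edgeCorrespondence.ConditionS ∧
      ∀ x : ι → Matrix κ κ ℂ, ∃ a b : ι, a ≠ b ∧ ∀ k : ℕ,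
        ∃ ξ : (G.edgeCorrespondence.tpow (k + 1)).carrier,
          (∃ c : ℝ, 0 < c ∧ ξ = (c : ℂ) • G.pathVector (Pi.single a 1) (Pi.single b 1) k) ∧
          (G.edgeCorrespondence.tpow (k + 1)).norm ξ = 1 ∧
          G.edgeCorrespondence.IsNonReturning ξ ∧
          ‖(G.edgeCorrespondence.tpow (k + 1)).inner ξ
            ((G.edgeCorrespondence.tpow (k + 1)).left x ξ)‖ = ‖x‖ :=
  ⟨FaithfulState.existsUnique_isTracial_isDeltaForm fun _ : ι => κ,
    exists_isTracial_and_A_eq_digraphMap D κ,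
    fun _ hA => ⟨QuantumGraph.conditionS_of_A_eq_digraphMap hA hD,
      QuantumGraph.exists_isNonReturning_smul_pathVector hA hD⟩⟩

theorem mainTheorem6 (n : ℕ) (hn : 1 ≤ n) :
    (∃! ψ : FaithfulState (ThreeBlocks n), ψ.IsTracial ∧ ∃ δ : ℝ, ψ.IsDeltaForm δ) ∧
    (∃ G : QuantumGraph (ThreeBlocks n), IsThreeBlockGraph G) ∧
    ∀ G : QuantumGraph (ThreeBlocks n), IsThreeBlockGraph G →
      G.edgeCorrespondence.ConditionS ∧
      ∀ x : ThreeBlocks n, ∃ a b : Fin 3, a ≠ b ∧ ∀ k : ℕ,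
        ∃ ξ : (G.edgeCorrespondence.tpow (k + 1)).carrier,
          (∃ c : ℝ, 0 < c ∧ ξ = (c : ℂ) • G.pathVector (blockProj a) (blockProj b) k) ∧
          (G.edgeCorrespondence.tpow (k + 1)).norm ξ = 1 ∧
          G.edgeCorrespondence.IsNonReturning ξ ∧
          ‖(G.edgeCorrespondence.tpow (k + 1)).inner ξ
            ((G.edgeCorrespondence.tpow (k + 1)).left x ξ)‖ = ‖x‖ := by
  have : Nonempty (Fin n) := ⟨⟨0, hn⟩⟩
  simp only [QuantumGraph.isThreeBlockGraph_iff]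
  obtain ⟨h_unique, h_exists, h_paths⟩ :=
    mainTheorem6_general (κ := Fin n) threeBlockDigraph threeBlockDigraph_exists_loop_edge
  exact ⟨h_unique, h_exists, fun G hG => h_paths G hG.2⟩
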